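/- Let $R(A_1,\dots,A_d)$ be a relation schema, let its attributes take values in a (possibly infinite) domain $\mathrm{dom}$ whose elements are represented by binary strings, distinct elements by distinct strings, and let $\Sigma$ be a finite set of functional dependencies (FDs) $X\to Y$ with $X,Y\subseteq\{A_1,\dots,A_d\}$. An instance is a finite set $I\subseteq\mathrm{dom}^d$; it satisfies $X\to Y$ if any two tuples of $I$ that agree on $X$ also agree on $Y$, and it satisfies $\Sigma$ if it satisfies every FD in $\Sigma$. Two sets of FDs over $R$ are equivalent if they are satisfied by the same instances. A set of FDs has an lhs chain if for any two of its members $X_1\to Y_1$ and $X_2\to Y_2$, either $X_1\subseteq X_2$ or $X_2\subseteq X_1$. A subset repair of an instance $D$ is an inclusion-maximal subset of $D$ that satisfies $\Sigma$. Let $\mathbf{R}=(R(A_1,\dots,A_d),\Sigma)$ be fixed. The problem $\textsc{Min-Repair}\langle\mathbf{R}\rangle$ is: given an instance $D$ with a rational weight $w_t\ge 0$ for each tuple $t\in D$ (numerators and denominators written in binary), find a subset repair $E$ of $D$ whose total weight $\sum_{t\in E}w_t$ is minimum among all subset repairs of $D$. **Theorem.** If $\Sigma$ is equivalent to a set of FDs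 over $R$ that has an lhs chain, then $\textsc{Min-Repair}\langle\mathbf{R}\rangle$ is solvable in polynomial time: there is a Turing machine that, on every input $(D,w)$, outputs a subset repair of $D$ of minimum total weight, in time polynomial in the length of the encoded input. -/

import Mathlib

namespace MinRepair

/-- A tuple over a relation schema with `d` attributes `0, …, d - 1` and values in `dom`. -/
abbrev Tuple (d : ℕ) (dom : Type) : Type := Fin d → dom

/-- A functional dependency `lhs → rhs` over `d` attributes. -/
structure FD (d : ℕ) where
  lhs : Finset (Fin d)
  rhs : Finset (Fin d)

/-- An instance satisfies `X → Y` if any two of its tuples that agree on `X` also agree on `Y`. -/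
def FD.Holds {d : ℕ} {dom : Type} (φ : FD d) (I : Finset (Tuple d dom)) : Prop :=
  ∀ s ∈ I, ∀ t ∈ I, (∀ i ∈ φ.lhs, s i = t i) → ∀ i ∈ φ.rhs, s i = t i

/-- The instance `I` satisfies every functional dependency of `S`. -/
def Satisfies {d : ℕ} {dom : Type} (I : Finset (Tuple d dom)) (S : Finset (FD d)) : Prop :=
  ∀ φ ∈ S, φ.Holds I

/-- Equivalence of two sets of functional dependencies over the same relation schema:
the same instances satisfy them. -/
def Equivalent {d : ℕ} (dom : Type) (S T : Finset (FD d)) : Prop :=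
  ∀ I : Finset (Tuple d dom), Satisfies I S ↔ Satisfies I T

/-- The left-hand sides are pairwise comparable for inclusion. -/
def HasLhsChain {d : ℕ} (S : Finset (FD d)) : Prop :=
  ∀ φ ∈ S, ∀ ψ ∈ S, φ.lhs ⊆ ψ.lhs ∨ ψ.lhs ⊆ φ.lhs

/-- `E` is a subset repair of `D`: an inclusion-maximal subset of `D` that satisfies `S`. -/
def IsRepair {d : ℕ} {dom : Type} (S : Finset (FD d)) (D E : Finset (Tuple d dom)) : Prop :=
  Maximal (fun I => I ⊆ D ∧ Satisfies I S) E

/-- A finite instance with a nonnegative rational weight on each tuple, listed row by row.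
No tuple is listed twice. -/
structure WeightedInstance (d : ℕ) (dom : Type) where
  rows : List (Tuple d dom × ℚ≥0)
  nodup : (rows.map Prod.fst).Nodup

/-- The underlying set of tuples. -/
def WeightedInstance.tuples {d : ℕ} {dom : Type} [DecidableEq dom]
    (D : WeightedInstance d dom) : Finset (Tuple d dom) :=
  (D.rows.map Prod.fst).toFinset

/-- The total weight of the tuples of `D` that belong to `E`. -/
def WeightedInstance.weight {d : ℕ} {dom : Type} [DecidableEq dom]
    (D : WeightedInstance d dom) (E : Finset (Tuple d dom)) : ℚ≥0 :=
  ((D.rows.filter (fun r => r.1 ∈ E)).map Prod.snd).sum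

/-- `E` is a subset repair of `D` of minimum total weight. -/
def IsMinRepair {d : ℕ} {dom : Type} [DecidableEq dom] (S : Finset (FD d))
    (D : WeightedInstance d dom) (E : Finset (Tuple d dom)) : Prop :=
  IsRepair S D.tuples E ∧ ∀ E', IsRepair S D.tuples E' → D.weight E ≤ D.weight E'

/-- The alphabet of the encodings: bits, a mark that ends a field and a mark that ends a row. -/
inductive Sym where
  | bit (b : Bool)
  | endField
  | endRow
  deriving DecidableEq, Fintype

/-- A field that holds a bit string. -/
def encodeField (l : List Bool) : List Sym := l.map Sym.bit ++ [Sym.endField]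

/-- The values of a tuple, one field each, in the order of the attributes, where `enc` is the
binary encoding of the domain. -/
def encodeTuple {d : ℕ} {dom : Type} (enc : dom → List Bool) (t : Tuple d dom) : List Sym :=
  (List.ofFn t).flatMap (fun a => encodeField (enc a))

/-- A row for each tuple of an instance: its values, followed by the numerator and the denominator
of its weight in binary. -/
def encodeInstance {d : ℕ} {dom : Type} (enc : dom → List Bool)
    (D : WeightedInstance d dom) : List Sym :=
  D.rows.flatMap (fun r => encodeTuple enc r.1 ++
    encodeField (Computability.encodeNat r.2.num) ++
    encodeField (Computability.encodeNat r.2.den) ++ [Sym.endRow])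

/-- A row for each tuple of a list of tuples. -/
def encodeTuples {d : ℕ} {dom : Type} (enc : dom → List Bool)
    (l : List (Tuple d dom)) : List Sym :=
  l.flatMap (fun t => encodeTuple enc t ++ [Sym.endRow])

/-- The search problem "given `a`, find some `b` with `R a b`" is solved by a Turing machine in
time polynomial in the length of the encoded input. -/
def SolvableInPolyTime {α β Γ₁ Γ₂ : Type} (encIn : α → List Γ₁) (encOut : β → List Γ₂)
    (R : α → β → Prop) : Prop :=
  ∃ f : α → β, Nonempty (Turing.TM2ComputableInPolyTime encIn encOut f) ∧ ∀ a, R a (f a)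

/-- The problem Min-Repair for the fixed set `S`: given a weighted instance `D`, list, without
repetition, the tuples of a subset repair of `D` of minimum total weight. -/
def MinRepairSolution {d : ℕ} {dom : Type} [DecidableEq dom] (S : Finset (FD d))
    (D : WeightedInstance d dom) (l : List (Tuple d dom)) : Prop :=
  l.Nodup ∧ IsMinRepair S D l.toFinset

end MinRepair

/-! Subset repairs depend on Σ only through satisfaction, so Σ may be replaced by dependencies X₁ →
Y₁, …, Xₙ → Yₙ with X₁ ⊆ … ⊆ Xₙ. Tuples that violate any of them agree on X₁. Hence tuples of
different X₁-classes never conflict, and minimum repairs can be found class by class (`IsRep.cls`,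
`isMinRep_of_cls`). Within one X₁-class, X₁ → Y₁ confines a repair to a single Y₁-block, where it is
a repair for the remaining dependencies. Conversely a repair of a block is nonempty, so no
consistent extension can leave the block. A lightest one among the minimum repairs of the blocks is
therefore a minimum repair of the class (`isMinRep_cons`), and the blocks are treated recursively.

The recursion is unrolled into one filtering pass per dependency, the last dependency first. The
pass for X → Y groups the surviving tuples by X and all attributes of the earlier dependencies, and
keeps in each group a Y-block of least weight. Earlier passes have already reduced every block to a
minimum repair, so its current weight is the right one to compare (`IsRun.isMinRep`). The number of
passes is fixed.

For the time bound, a small loop language on four stacks is compiled to Turing machines without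
increasing the step bound (`Runs.reach`). Data are binary trees in a self-delimiting prefix code.
The functions computable in this way in polynomial time (`PT`) are closed under composition,
pairing, case distinction, and folds whose intermediate values have polynomial size (`PT.foldl`,
`PT.foldl_of_growth`). Parsing, exact arithmetic and the passes are all expressed by such folds.
Weights are summed as unreduced fractions, whose lengths grow additively with each summand
(`PT.sumFrac`). -/

open Turing

namespace MinRepair

/-! ### Stack programs and their compilation to Turing machines. -/

/-- The stacks of the machines below: a main stack, two auxiliary ones and a counter. -/
inductive Stk where
  | m | a | b | c
  deriving DecidableEq

instance : Fintype Stk := ⟨{.m, .a, .b, .c}, fun k => by cases k <;> simp⟩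

/-- A structured language of programs that act on the stacks. -/
inductive Cmd where
  | skip : Cmd
  | push : Stk → Sym → Cmd
  | pop : Stk → (Option Sym → Cmd) → Cmd
  | loop : Stk → (Sym → Cmd) → Cmd
  | seq : Cmd → Cmd → Cmd

namespace Cmd

/-- `Runs p S S' t`: started on the stacks `S`, the program `p` ends with the stacks `S'`
after at most `t` steps. -/
inductive Runs : Cmd → (Stk → List Sym) → (Stk → List Sym) → ℕ → Prop
  | skip (S) : Runs skip S S 1
  | push (S k x) : Runs (push k x) S (Function.update S k (x :: S k)) 1
  | pop {S S' k body t} :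
      Runs (body (S k).head?) (Function.update S k (S k).tail) S' t →
      Runs (pop k body) S S' (t + 1)
  | loop_nil {S k body} : S k = [] → Runs (loop k body) S S 1
  | loop_cons {S S' S'' k body x l t t'} : S k = x :: l →
      Runs (body x) (Function.update S k l) S' t → Runs (loop k body) S' S'' t' →
      Runs (loop k body) S S'' (t + t' + 1)
  | seq {p q S S' S'' t t'} : Runs p S S' t → Runs q S' S'' t' → Runs (seq p q) S S'' (t + t')
  | mono {p S S' t t'} : Runs p S S' t → t ≤ t' → Runs p S S' t'

/-- A step pushes at most one symbol. Running time thus bounds output size, which is what bounds the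
second program's time in a composition. -/
theorem Runs.length_le {p : Cmd} {S S' : Stk → List Sym} {t : ℕ} (h : Runs p S S' t) (k : Stk) :
    (S' k).length ≤ (S k).length + t := by
  induction h with
  | skip S => omega
  | push S j x =>
    by_cases hk : k = j
    · subst hk; simp
    · simp [Function.update_of_ne hk]
  | @pop S S' j body t _ ih =>
    by_cases hk : k = j
    · subst hk; simp at ih; omega
    · simp [Function.update_of_ne hk] at ih; omega
  | loop_nil _ => omega
  | @loop_cons S S' S'' j body x l t t' hS _ _ ih ih' =>
    by_cases hk : k = j
    · subst hk; simp at ih; simp [hS]; omega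
    · simp [Function.update_of_ne hk] at ih; omega
  | seq _ _ ih ih' => omega
  | mono _ _ ih => omega

/-- The labels of the compiled program. -/
@[reducible] def Lab : Cmd → Type
  | skip => Unit
  | push _ _ => Unit
  | pop _ body => Unit ⊕ (Σ o : Option Sym, Lab (body o))
  | loop _ body => Unit ⊕ (Σ x : Sym, Lab (body x))
  | seq p q => Lab p ⊕ Lab q

theorem finite_lab : ∀ p : Cmd, Finite (Lab p)
  | skip => inferInstanceAs (Finite Unit)
  | push _ _ => inferInstanceAs (Finite Unit)
  | pop _ body =>
    have := fun o => finite_lab (body o)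
    inferInstanceAs (Finite (Unit ⊕ (Σ o : Option Sym, Lab (body o))))
  | loop _ body =>
    have := fun x => finite_lab (body x)
    inferInstanceAs (Finite (Unit ⊕ (Σ x : Sym, Lab (body x))))
  | seq p q =>
    have := finite_lab p
    have := finite_lab q
    inferInstanceAs (Finite (Lab p ⊕ Lab q))

/-- The label at which the compiled program starts. -/
def entry : (p : Cmd) → Lab p
  | skip => ()
  | push _ _ => ()
  | pop _ _ => Sum.inl ()
  | loop _ _ => Sum.inl ()
  | seq p _ => Sum.inl (entry p)

/-- The statements of the machines. -/
abbrev MStmt (L : Type) : Type := TM2.Stmt (fun _ : Stk => Sym) L (Option Sym)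

/-- The compiled program, with its labels embedded in `L` and continuing at `exit`. -/
def compile {L : Type} : (p : Cmd) → (Lab p → L) → L → Lab p → MStmt L
  | skip, _, exit, _ => .goto fun _ => exit
  | push k x, _, exit, _ => .push k (fun _ => x) (.goto fun _ => exit)
  | pop k body, emb, _, Sum.inl _ =>
    .pop k (fun _ o => o) (.goto fun v => emb (Sum.inr ⟨v, entry (body v)⟩))
  | pop _ body, emb, exit, Sum.inr ⟨o, l⟩ =>
    compile (body o) (fun l => emb (Sum.inr ⟨o, l⟩)) exit l
  | loop k body, emb, exit, Sum.inl _ =>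
    .pop k (fun _ o => o) (.goto fun v => v.elim exit fun x => emb (Sum.inr ⟨x, entry (body x)⟩))
  | loop _ body, emb, _, Sum.inr ⟨x, l⟩ =>
    compile (body x) (fun l => emb (Sum.inr ⟨x, l⟩)) (emb (Sum.inl ())) l
  | seq p q, emb, _, Sum.inl l =>
    compile p (fun l => emb (Sum.inl l)) (emb (Sum.inr (entry q))) l
  | seq _ q, emb, exit, Sum.inr l => compile q (fun l => emb (Sum.inr l)) exit l

/-- `n` steps of the machine `M` lead from one configuration to the other. -/
def Reach {L : Type} (M : L → MStmt L) (n : ℕ)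
    (x y : TM2.Cfg (fun _ : Stk => Sym) L (Option Sym)) : Prop :=
  (flip bind (TM2.step M))^[n] (some x) = some y

theorem Reach.trans {L : Type} {M : L → MStmt L} {n k : ℕ}
    {x y z : TM2.Cfg (fun _ : Stk => Sym) L (Option Sym)}
    (h : Reach M n x y) (h' : Reach M k y z) : Reach M (n + k) x z := by
  unfold Reach at *
  rw [add_comm, Function.iterate_add_apply, h, h']

theorem Reach.one {L : Type} {M : L → MStmt L}
    {x y : TM2.Cfg (fun _ : Stk => Sym) L (Option Sym)}
    (h : TM2.step M x = some y) : Reach M 1 x y := h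

/-- Induction on the run. With `emb` and `exit` arbitrary, the machine of a whole program serves for
each of its parts; the exit of a loop body is the head of the loop. The register `v` may be
arbitrary because every pop overwrites it before it is read. -/
theorem Runs.reach {p : Cmd} {S S' : Stk → List Sym} {t : ℕ} (h : Runs p S S' t) :
    ∀ {L : Type} (M : L → MStmt L) (emb : Lab p → L) (exit : L),
      (∀ l, M (emb l) = compile p emb exit l) → ∀ v, ∃ v', ∃ n ≤ t,
        Reach M n ⟨some (emb (entry p)), v, S⟩ ⟨some exit, v', S'⟩ := by
  induction h with
  | skip S =>
    intro L M emb exit hM v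
    exact ⟨v, 1, le_rfl, Reach.one (by simp [hM, compile])⟩
  | push S j x =>
    intro L M emb exit hM v
    exact ⟨v, 1, le_rfl, Reach.one (by simp [hM, compile])⟩
  | @pop S S' j body t _ ih =>
    intro L M emb exit hM v
    obtain ⟨v', n, hn, h⟩ := ih M (fun l => emb (Sum.inr ⟨_, l⟩)) exit
      (fun l => hM _) (S j).head?
    refine ⟨v', 1 + n, by omega, Reach.trans (Reach.one ?_) h⟩
    simp [(hM (Sum.inl ())), compile, entry]
  | @loop_nil S k body hS =>
    intro L M emb exit hM v
    refine ⟨none, 1, le_rfl, Reach.one ?_⟩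
    have : Function.update S k [] = S := by rw [← hS]; simp
    simp [(hM (Sum.inl ())), compile, entry, hS, this]
  | @loop_cons S S' S'' j body x l t t' hS _ _ ih ih' =>
    intro L M emb exit hM v
    obtain ⟨v', n, hn, h⟩ := ih M (fun l => emb (Sum.inr ⟨_, l⟩)) (emb (Sum.inl ()))
      (fun l => hM _) (some x)
    obtain ⟨v'', n', hn', h'⟩ := ih' M emb exit hM v'
    refine ⟨v'', 1 + n + n', by omega, Reach.trans (Reach.trans (Reach.one ?_) h) h'⟩
    simp [(hM (Sum.inl ())), compile, entry, hS]
  | seq _ _ ih ih' =>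
    intro L M emb exit hM v
    obtain ⟨v', n, hn, h⟩ := ih M (fun l => emb (Sum.inl l)) (emb (Sum.inr (entry _)))
      (fun l => hM _) v
    obtain ⟨v'', n', hn', h'⟩ := ih' M (fun l => emb (Sum.inr l)) exit
      (fun l => hM _) v'
    exact ⟨v'', n + n', by omega, Reach.trans h h'⟩
  | mono _ hle ih =>
    intro L M emb exit hM v
    obtain ⟨v', n, hn, h⟩ := ih M emb exit hM v
    exact ⟨v', n, hn.trans hle, h⟩

/-- The machine that runs the program `p`, with its input on the stack `a` and its output on the
stack `b`. -/
noncomputable def machine (p : Cmd) : FinTM2 where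
  K := Stk
  k₀ := Stk.a
  k₁ := Stk.b
  Γ _ := Sym
  Λ := Option (Lab p)
  main := some (entry p)
  ΛFin := @instFintypeOption _ (@Fintype.ofFinite _ (finite_lab p))
  σ := Option Sym
  initialState := none
  -- A final configuration must carry the initial register value, so the exit label `none` clears
  -- the register before halting.
  m l := l.elim (.load (fun _ => none) .halt) (compile p some none)

end Cmd

/-- The stacks with the given contents. -/
def stk (m a b c : List Sym) : Stk → List Sym
  | .m => m
  | .a => a
  | .b => b
  | .c => c

section

variable (m a b c l : List Sym)

@[simp] theorem stk_m : stk m a b c .m = m := rfl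
@[simp] theorem stk_a : stk m a b c .a = a := rfl
@[simp] theorem stk_b : stk m a b c .b = b := rfl
@[simp] theorem stk_c : stk m a b c .c = c := rfl

@[simp] theorem update_stk_m :
    Function.update (stk m a b c) .m l = stk l a b c := by
  funext k; cases k <;> rfl

@[simp] theorem update_stk_a :
    Function.update (stk m a b c) .a l = stk m l b c := by
  funext k; cases k <;> rfl

@[simp] theorem update_stk_b :
    Function.update (stk m a b c) .b l = stk m a l c := by
  funext k; cases k <;> rfl

@[simp] theorem update_stk_c :
    Function.update (stk m a b c) .c l = stk m a b l := by
  funext k; cases k <;> rfl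

end

/-- A function that a program computes in polynomial time is computed by a Turing machine in
polynomial time. -/
theorem Cmd.computableInPolyTime {α β : Type} {ea : α → List Sym} {eb : β → List Sym}
    {f : α → β} (p : Cmd) (P : Polynomial ℕ)
    (h : ∀ x, Runs p (stk [] (ea x) [] []) (stk [] [] (eb (f x)) [])
      (P.eval (ea x).length)) :
    Nonempty (TM2ComputableInPolyTime ea eb f) := by
  have key : ∀ x, ∃ n ≤ P.eval (ea x).length + 1,
      Reach (machine p).m n
        ⟨some (some (entry p)), none, stk [] (ea x) [] []⟩
        ⟨none, none, stk [] [] (eb (f x)) []⟩ := by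
    intro x
    obtain ⟨v', n, hn, hr⟩ := (h x).reach (machine p).m some none (fun l => rfl) none
    refine ⟨n + 1, by omega, Reach.trans hr (Reach.one ?_)⟩
    simp [machine]
  choose n hn hr using key
  refine ⟨⟨⟨machine p, Equiv.refl _, Equiv.refl _⟩, P + 1, fun x => ⟨⟨n x, ?_⟩, ?_⟩⟩⟩
  · have h1 : initList (machine p) (List.map (Equiv.refl Sym).invFun (ea x)) =
        ⟨some (some (entry p)), none, stk [] (ea x) [] []⟩ := by
      simp only [initList]
      congr 1
      funext k
      cases k <;> simp [machine] <;> rfl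
    have h2 : haltList (machine p) (List.map (Equiv.refl Sym).invFun (eb (f x))) =
        ⟨none, none, stk [] [] (eb (f x)) []⟩ := by
      simp only [haltList]
      congr 1
      funext k
      cases k <;> simp [machine] <;> rfl
    have := hr x
    unfold Reach at this
    refine (congrArg _ (congrArg some h1)).trans (this.trans ?_)
    exact (congrArg some h2).symm
  · simpa using hn x

/-! ### Trees in prefix code and stack routines for them. -/

/-- Binary trees, the data on which the programs operate. -/
inductive BTree where
  | nil : BTree
  | node : BTree → BTree → BTree

/-- The prefix code of a tree. -/
def BTree.flat : BTree → List Sym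
  | nil => [Sym.bit false]
  | node x y => Sym.bit true :: (x.flat ++ y.flat)

/-- The length of the prefix code of a tree. -/
def BTree.size (x : BTree) : ℕ := x.flat.length

@[simp] theorem BTree.size_nil : BTree.nil.size = 1 := rfl

@[simp] theorem BTree.size_node (x y : BTree) : (BTree.node x y).size = x.size + y.size + 1 := by
  simp [size, flat]

namespace Cmd

section

variable {m a b c l : List Sym} {x : Sym} {S S' : Stk → List Sym} {t t' : ℕ}

theorem runs_push_m : Runs (push .m x) (stk m a b c) (stk (x :: m) a b c) 1 := by
  simpa using Runs.push (stk m a b c) .m x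

theorem runs_push_a : Runs (push .a x) (stk m a b c) (stk m (x :: a) b c) 1 := by
  simpa using Runs.push (stk m a b c) .a x

theorem runs_push_b : Runs (push .b x) (stk m a b c) (stk m a (x :: b) c) 1 := by
  simpa using Runs.push (stk m a b c) .b x

theorem runs_push_c : Runs (push .c x) (stk m a b c) (stk m a b (x :: c)) 1 := by
  simpa using Runs.push (stk m a b c) .c x

theorem runs_pop_m {body : Option Sym → Cmd} (h : Runs (body (some x)) (stk l a b c) S t) :
    Runs (pop .m body) (stk (x :: l) a b c) S (t + 1) := by
  refine Runs.pop ?_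
  simpa using h

theorem runs_loop_a {body : Sym → Cmd} (h : Runs (body x) (stk m l b c) S t)
    (h' : Runs (loop .a body) S S' t') :
    Runs (loop .a body) (stk m (x :: l) b c) S' (t + t' + 1) :=
  Runs.loop_cons (l := l) rfl (by simpa using h) h'

theorem runs_loop_c {body : Sym → Cmd} (h : Runs (body x) (stk m a b l) S t)
    (h' : Runs (loop .c body) S S' t') :
    Runs (loop .c body) (stk m a b (x :: l)) S' (t + t' + 1) :=
  Runs.loop_cons (l := l) rfl (by simpa using h) h'

end

/-- Push the symbols of a list, the last one first. -/
def pushList (k : Stk) : List Sym → Cmd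
  | [] => skip
  | x :: l => seq (pushList k l) (push k x)

theorem runs_pushList (k : Stk) (l : List Sym) (S : Stk → List Sym) :
    Runs (pushList k l) S (Function.update S k (l ++ S k)) (l.length + 1) := by
  induction l with
  | nil => simpa [pushList] using Runs.skip S
  | cons x l ih =>
    have := Runs.seq ih (Runs.push _ k x)
    simp only [Function.update_idem, Function.update_self] at this
    exact this

/-- Empty the stack `k` onto the stack `j`. -/
def transfer (k j : Stk) : Cmd := loop k fun x => push j x

theorem runs_transfer {k j : Stk} (hkj : j ≠ k) (l : List Sym) :
    ∀ S : Stk → List Sym, S k = l → Runs (transfer k j) S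
      (Function.update (Function.update S k []) j (l.reverse ++ S j)) (2 * l.length + 1) := by
  induction l with
  | nil =>
    intro S hS
    have : Function.update (Function.update S k []) j (S j) = S := by
      rw [Function.update_comm hkj.symm, Function.update_eq_self, ← hS, Function.update_eq_self]
    have h : Runs (transfer k j) S S 1 := Runs.loop_nil hS
    simpa [this] using h
  | cons x l ih =>
    intro S hS
    have h : Runs (transfer k j) _ _ _ := Runs.loop_cons hS (Runs.push _ j x)
      (ih _ (by simp [Function.update_of_ne hkj.symm]))
    have e : 1 + (2 * l.length + 1) + 1 = 2 * (x :: l).length + 1 := by simp; omega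
    rw [e] at h
    convert h using 1
    rw [Function.update_self, Function.update_of_ne hkj, Function.update_comm hkj,
      Function.update_idem, Function.update_idem]
    simp

theorem runs_transfer_am (m a b c : List Sym) :
    Runs (transfer .a .m) (stk m a b c) (stk (a.reverse ++ m) [] b c) (2 * a.length + 1) := by
  simpa using runs_transfer (by decide : Stk.m ≠ Stk.a) a (stk m a b c) rfl

theorem runs_transfer_bm (m a b c : List Sym) :
    Runs (transfer .b .m) (stk m a b c) (stk (b.reverse ++ m) a [] c) (2 * b.length + 1) := by
  simpa using runs_transfer (by decide : Stk.m ≠ Stk.b) b (stk m a b c) rfl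

theorem runs_transfer_ba (m a b c : List Sym) :
    Runs (transfer .b .a) (stk m a b c) (stk m (b.reverse ++ a) [] c) (2 * b.length + 1) := by
  simpa using runs_transfer (by decide : Stk.a ≠ Stk.b) b (stk m a b c) rfl

/-- Execute a body for each subtree on the main stack that the counter still asks for. -/
def moveLoop (k : Stk) : Cmd :=
  loop .c fun _ => pop .m fun o => match o with
    | none => skip
    | some x => seq (push k x)
        (if x = Sym.bit true then pushList .c [Sym.endRow, Sym.endRow] else skip)

/-- The counter has one mark for each tree still to be moved: a leaf uses up a mark, a node trades
one for two. The rest of the run is a hypothesis, so that the moves of the two subtrees can be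
chained in the induction. -/
theorem runs_moveLoop_a (x : BTree) : ∀ {r a b c : List Sym} {S : Stk → List Sym} {t : ℕ},
    Runs (moveLoop .a) (stk r (x.flat.reverse ++ a) b c) S t →
    Runs (moveLoop .a) (stk (x.flat ++ r) a b (Sym.endRow :: c)) S (6 * x.size + t) := by
  induction x with
  | nil =>
    intro r a b c S t h
    refine Runs.mono (runs_loop_c (t := 3) ?_ h) (by simp only [BTree.size_nil]; omega)
    refine runs_pop_m (t := 2) ?_
    simpa [BTree.flat] using Runs.seq (runs_push_a (m := r) (a := a) (b := b) (c := c) (x := Sym.bit false)) (Runs.skip _)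
  | node x y ihx ihy =>
    intro r a b c S t h
    have h1 := ihx (r := y.flat ++ r) (a := Sym.bit true :: a) (c := Sym.endRow :: c)
      (ihy (by simpa [BTree.flat] using h))
    refine Runs.mono (runs_loop_c (t := 5) ?_ h1) (by simp; omega)
    refine runs_pop_m (t := 4) ?_
    simpa [BTree.flat] using Runs.seq (runs_push_a (m := x.flat ++ (y.flat ++ r)) (a := a) (b := b)
      (c := c) (x := Sym.bit true)) (runs_pushList .c [Sym.endRow, Sym.endRow] _)

theorem runs_moveLoop_b (x : BTree) : ∀ {r a b c : List Sym} {S : Stk → List Sym} {t : ℕ},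
    Runs (moveLoop .b) (stk r a (x.flat.reverse ++ b) c) S t →
    Runs (moveLoop .b) (stk (x.flat ++ r) a b (Sym.endRow :: c)) S (6 * x.size + t) := by
  induction x with
  | nil =>
    intro r a b c S t h
    refine Runs.mono (runs_loop_c (t := 3) ?_ h) (by simp only [BTree.size_nil]; omega)
    refine runs_pop_m (t := 2) ?_
    simpa [BTree.flat] using Runs.seq (runs_push_b (m := r) (a := a) (b := b) (c := c) (x := Sym.bit false)) (Runs.skip _)
  | node x y ihx ihy =>
    intro r a b c S t h
    have h1 := ihx (r := y.flat ++ r) (b := Sym.bit true :: b) (c := Sym.endRow :: c)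
      (ihy (by simpa [BTree.flat] using h))
    refine Runs.mono (runs_loop_c (t := 5) ?_ h1) (by simp; omega)
    refine runs_pop_m (t := 4) ?_
    simpa [BTree.flat] using Runs.seq (runs_push_b (m := x.flat ++ (y.flat ++ r)) (a := a) (b := b)
      (c := c) (x := Sym.bit true)) (runs_pushList .c [Sym.endRow, Sym.endRow] _)

/-- Move the topmost tree of the main stack to the stack `k`, which reverses its code. -/
def moveTree (k : Stk) : Cmd := seq (push .c Sym.endRow) (moveLoop k)

theorem runs_moveTree_a (x : BTree) (r a b : List Sym) :
    Runs (moveTree .a) (stk (x.flat ++ r) a b []) (stk r (x.flat.reverse ++ a) b [])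
      (6 * x.size + 2) := by
  refine Runs.mono (Runs.seq runs_push_c
    (runs_moveLoop_a x (t := 1) (Runs.loop_nil rfl))) (by omega)

theorem runs_moveTree_b (x : BTree) (r a b : List Sym) :
    Runs (moveTree .b) (stk (x.flat ++ r) a b []) (stk r a (x.flat.reverse ++ b) [])
      (6 * x.size + 2) := by
  refine Runs.mono (Runs.seq runs_push_c
    (runs_moveLoop_b x (t := 1) (Runs.loop_nil rfl))) (by omega)

/-- Exchange the two topmost trees of the main stack. -/
def swap : Cmd :=
  seq (moveTree .a) (seq (moveTree .b) (seq (transfer .a .m) (transfer .b .m)))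

theorem runs_swap (x y : BTree) (r : List Sym) :
    Runs swap (stk (x.flat ++ (y.flat ++ r)) [] [] []) (stk (y.flat ++ (x.flat ++ r)) [] [] [])
      (8 * (x.size + y.size) + 6) := by
  have h := Runs.seq (runs_moveTree_a x (y.flat ++ r) [] [])
    (Runs.seq (runs_moveTree_b y r _ []) (Runs.seq (runs_transfer_am _ _ _ _)
      (runs_transfer_bm _ _ _ _)))
  simp only [List.append_nil, List.reverse_reverse, List.length_reverse] at h
  exact Runs.mono h (by simp only [BTree.size]; omega)

/-- Insert a node symbol between the topmost tree and the rest of the main stack. -/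
def nodeBelow : Cmd :=
  seq (moveTree .a) (seq (push .m (Sym.bit true)) (transfer .a .m))

theorem runs_nodeBelow (x : BTree) (r : List Sym) :
    Runs nodeBelow (stk (x.flat ++ r) [] [] []) (stk (x.flat ++ Sym.bit true :: r) [] [] [])
      (8 * x.size + 4) := by
  have h := Runs.seq (runs_moveTree_a x r [] [])
    (Runs.seq (runs_push_m (x := Sym.bit true)) (runs_transfer_am _ _ _ _))
  simp only [List.append_nil, List.reverse_reverse, List.length_reverse] at h
  exact Runs.mono h (by simp only [BTree.size]; omega)

/-- Drop the topmost tree of the main stack. -/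
def drop : Cmd := seq (moveTree .a) (loop .a fun _ => skip)

theorem runs_loop_skip (a : List Sym) (r b c : List Sym) :
    Runs (loop .a fun _ => skip) (stk r a b c) (stk r [] b c) (2 * a.length + 1) := by
  induction a with
  | nil => exact Runs.mono (Runs.loop_nil rfl) (by simp)
  | cons x l ih => exact Runs.mono (runs_loop_a (Runs.skip _) ih) (by simp; omega)

theorem runs_drop (x : BTree) (r : List Sym) :
    Runs drop (stk (x.flat ++ r) [] [] []) (stk r [] [] []) (8 * x.size + 3) := by
  have h := Runs.seq (runs_moveTree_a x r [] []) (runs_loop_skip _ _ _ _)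
  exact Runs.mono h (by simp [BTree.size]; omega)

/-- Copy the topmost tree of the main stack. -/
def dup : Cmd :=
  seq (moveTree .a) (seq (loop .a fun x => seq (push .m x) (push .b x))
    (seq (transfer .b .a) (transfer .a .m)))

theorem runs_copyLoop (a : List Sym) : ∀ m b : List Sym,
    Runs (loop .a fun x => seq (push .m x) (push .b x)) (stk m a b [])
      (stk (a.reverse ++ m) [] (a.reverse ++ b) []) (3 * a.length + 1) := by
  induction a with
  | nil => intro m b; exact Runs.mono (Runs.loop_nil rfl) (by simp)
  | cons x l ih =>
    intro m b
    have h := runs_loop_a (body := fun x => seq (push .m x) (push .b x))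
      (Runs.seq (runs_push_m (x := x)) (runs_push_b (x := x))) (ih (x :: m) (x :: b))
    simpa using Runs.mono h (by simp; omega)

theorem runs_dup (x : BTree) (r : List Sym) :
    Runs dup (stk (x.flat ++ r) [] [] []) (stk (x.flat ++ (x.flat ++ r)) [] [] [])
      (13 * x.size + 5) := by
  have h := Runs.seq (runs_moveTree_a x r [] []) (Runs.seq (runs_copyLoop _ _ _)
    (Runs.seq (runs_transfer_ba _ _ _ _) (runs_transfer_am _ _ _ _)))
  simp only [List.append_nil, List.reverse_reverse, List.length_reverse] at h
  exact Runs.mono h (by simp only [BTree.size]; omega)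

end Cmd

/-! ### Coded data types and closure properties of polynomial-time functions. -/

/-- A coding of the elements of a type by binary trees. -/
class Code (α : Type) where
  code : α → BTree

/-- The prefix code of the tree that codes an element. -/
def flat {α : Type} [Code α] (a : α) : List Sym := (Code.code a).flat

/-- The length of the code of an element. -/
def size {α : Type} [Code α] (a : α) : ℕ := (Code.code a).size

instance : Code Bool := ⟨fun b => cond b (.node .nil .nil) .nil⟩

instance {α β : Type} [Code α] [Code β] : Code (α × β) :=
  ⟨fun p => .node (Code.code p.1) (Code.code p.2)⟩

/-- The tree that codes a list. -/
def codeList {α : Type} [Code α] : List α → BTree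
  | [] => .nil
  | a :: l => .node (Code.code a) (codeList l)

instance {α : Type} [Code α] : Code (List α) := ⟨codeList⟩

section size

variable {α β : Type} [Code α] [Code β]

theorem length_flat (a : α) : (flat a).length = size a := rfl

theorem flat_prod (p : α × β) : flat p = Sym.bit true :: (flat p.1 ++ flat p.2) := rfl

theorem flat_pair (a : α) (b : β) : flat (a, b) = Sym.bit true :: (flat a ++ flat b) := rfl

theorem flat_cons (a : α) (l : List α) :
    flat (a :: l) = Sym.bit true :: (flat a ++ flat l) := rfl

theorem flat_true : flat true = [Sym.bit true, Sym.bit false, Sym.bit false] := rfl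

theorem flat_false : flat false = [Sym.bit false] := rfl

theorem size_pair (a : α) (b : β) : size (a, b) = size a + size b + 1 :=
  BTree.size_node _ _

theorem size_nil : size ([] : List α) = 1 := rfl

theorem size_cons (a : α) (l : List α) : size (a :: l) = size a + size l + 1 :=
  BTree.size_node _ _

theorem size_bool_le (b : Bool) : size b ≤ 3 := by cases b <;> decide

theorem size_append (l l' : List α) : size (l ++ l') + 1 = size l + size l' := by
  induction l with
  | nil => simp [size_nil]; omega
  | cons a l ih => simp only [List.cons_append, size_cons]; omega

theorem size_le_of_mem {a : α} {l : List α} (h : a ∈ l) : size a < size l := by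
  induction l with
  | nil => simp at h
  | cons b l ih =>
    rw [size_cons]
    rcases List.mem_cons.1 h with rfl | h
    · omega
    · have := ih h; omega

theorem length_lt_size (l : List α) : l.length < size l := by
  induction l with
  | nil => simp [size_nil]
  | cons a l ih => rw [size_cons, List.length_cons]; omega

end size

theorem eval_mono (P : Polynomial ℕ) {n k : ℕ} (h : n ≤ k) : P.eval n ≤ P.eval k := by
  rw [Polynomial.eval_eq_sum_range, Polynomial.eval_eq_sum_range]
  gcongr

open Cmd

/-- Some program computes the function in polynomial time, on the codes at the top of the main
stack. -/
def PT {α β : Type} [Code α] [Code β] (f : α → β) : Prop :=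
  ∃ (p : Cmd) (P : Polynomial ℕ), ∀ a r,
    Runs p (stk (flat a ++ r) [] [] []) (stk (flat (f a) ++ r) [] [] []) (P.eval (size a))

section

variable {α β : Type} [Code α] [Code β]

theorem Cmd.runs_swap_flat (a : α) (b : β) (r : List Sym) :
    Runs swap (stk (flat a ++ (flat b ++ r)) [] [] []) (stk (flat b ++ (flat a ++ r)) [] [] [])
      (8 * (size a + size b) + 6) :=
  runs_swap _ _ _

theorem Cmd.runs_drop_flat (a : α) (r : List Sym) :
    Runs drop (stk (flat a ++ r) [] [] []) (stk r [] [] []) (8 * size a + 3) :=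
  runs_drop _ _

theorem Cmd.runs_dup_flat (a : α) (r : List Sym) :
    Runs dup (stk (flat a ++ r) [] [] []) (stk (flat a ++ (flat a ++ r)) [] [] [])
      (13 * size a + 5) :=
  runs_dup _ _

theorem Cmd.runs_nodeBelow_flat (a : α) (r : List Sym) :
    Runs nodeBelow (stk (flat a ++ r) [] [] []) (stk (flat a ++ Sym.bit true :: r) [] [] [])
      (8 * size a + 4) :=
  runs_nodeBelow _ _

end

namespace PT

variable {α β γ δ : Type} [Code α] [Code β] [Code γ] [Code δ]

theorem of_eq {f g : α → β} (hf : PT f) (h : ∀ a, f a = g a) : PT g :=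
  (funext h : f = g) ▸ hf

/-- Nothing has to be computed when argument and value have the same code, as for `(a, l)` and `a ::
l`. -/
theorem of_flat_eq {f : α → β} (h : ∀ a, flat (f a) = flat a) : PT f :=
  ⟨skip, 1, fun a r => by simpa [h] using Runs.skip _⟩

theorem id : PT (fun a : α => a) := of_flat_eq fun _ => rfl

theorem size_le {f : α → β} (hf : PT f) :
    ∃ Q : Polynomial ℕ, ∀ a, size (f a) ≤ Q.eval (size a) := by
  obtain ⟨p, P, h⟩ := hf
  refine ⟨Polynomial.X + P, fun a => ?_⟩
  have := (h a []).length_le .m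
  simpa [length_flat] using this

theorem comp {g : β → γ} {f : α → β} (hg : PT g) (hf : PT f) : PT (fun a => g (f a)) := by
  obtain ⟨Q, hQ⟩ := hf.size_le
  obtain ⟨p, P, hp⟩ := hf
  obtain ⟨p', P', hp'⟩ := hg
  refine ⟨seq p p', P + P'.comp Q, fun a r => ?_⟩
  refine Runs.mono (Runs.seq (hp a r) (hp' (f a) r)) ?_
  simp only [Polynomial.eval_add, Polynomial.eval_comp]
  have := eval_mono P' (hQ a)
  omega

theorem const (b : β) : PT (fun _ : α => b) := by
  refine ⟨seq drop (pushList .m (flat b)),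
    8 * Polynomial.X + Polynomial.C (3 + ((flat b).length + 1)), fun a r => ?_⟩
  have h := Runs.seq (runs_drop_flat a r) (runs_pushList .m (flat b) _)
  simp only [update_stk_m, stk_m] at h
  exact Runs.mono h (by simp; omega)

theorem pair {f : α → β} {g : α → γ} (hf : PT f) (hg : PT g) : PT (fun a => (f a, g a)) := by
  obtain ⟨Q, hQ⟩ := hf.size_le
  obtain ⟨Q', hQ'⟩ := hg.size_le
  obtain ⟨p, P, hp⟩ := hf
  obtain ⟨p', P', hp'⟩ := hg
  -- From the top, the stack holds in turn `a, a`; `f a, a`; `a, f a`; `g a, f a`; `f a, g a`. A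
  -- node mark in front turns the last two codes into that of the pair.
  refine ⟨seq dup (seq p (seq swap (seq p' (seq swap (push .m (Sym.bit true)))))),
    21 * Polynomial.X + P + P' + 16 * Q + 8 * Q' + 18, fun a r => ?_⟩
  have h := Runs.seq (runs_dup_flat a r) (Runs.seq (hp a _)
    (Runs.seq (runs_swap_flat (f a) a _) (Runs.seq (hp' a _)
    (Runs.seq (runs_swap_flat (g a) (f a) _) (runs_push_m (x := Sym.bit true))))))
  rw [flat_pair, List.cons_append, List.append_assoc]
  refine Runs.mono h ?_
  have h1 := hQ a
  have h2 := hQ' a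
  simp
  omega

theorem fst : PT (fun p : α × β => p.1) := by
  refine ⟨pop .m fun _ => seq swap drop, 16 * Polynomial.X + 10, fun a r => ?_⟩
  have h := Runs.seq (runs_swap_flat a.1 a.2 r) (runs_drop_flat a.2 _)
  rw [flat_prod, List.cons_append, List.append_assoc]
  refine Runs.mono (runs_pop_m h) ?_
  have : size a = size a.1 + size a.2 + 1 := size_pair a.1 a.2
  simp
  omega

theorem snd : PT (fun p : α × β => p.2) := by
  refine ⟨pop .m fun _ => drop, 16 * Polynomial.X + 10, fun a r => ?_⟩
  have h := runs_drop_flat a.1 (flat a.2 ++ r)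
  rw [flat_prod, List.cons_append, List.append_assoc]
  refine Runs.mono (runs_pop_m h) ?_
  have : size a = size a.1 + size a.2 + 1 := size_pair a.1 a.2
  simp
  omega

theorem cond {b : α → Bool} {f g : α → β} (hb : PT b) (hf : PT f) (hg : PT g) :
    PT (fun a => bif b a then f a else g a) := by
  obtain ⟨p, P, hp⟩ := hb
  obtain ⟨q, Q, hq⟩ := hf
  obtain ⟨q', Q', hq'⟩ := hg
  -- The code of `true` has three symbols and that of `false` one, so the positive branch pops twice
  -- more.
  refine ⟨seq dup (seq p (pop .m fun o => if o = some (Sym.bit true) then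
    pop .m fun _ => pop .m fun _ => q else q')), 13 * Polynomial.X + P + Q + Q' + 8,
    fun a r => ?_⟩
  have h1 := runs_dup_flat a r
  have h2 := hp a (flat a ++ r)
  refine Runs.mono (Runs.seq h1 (Runs.seq h2 (t' := Q.eval (size a) + Q'.eval (size a) + 3) ?_)) ?_
  · change Runs _ _ (stk (flat (bif b a then f a else g a) ++ r) [] [] []) _
    cases b a with
    | true =>
      rw [flat_true]
      exact Runs.mono (runs_pop_m (t := Q.eval (size a) + 2) (runs_pop_m (runs_pop_m (hq a r))))
        (by omega)
    | false =>
      rw [flat_false]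
      exact Runs.mono (runs_pop_m (t := Q'.eval (size a)) (hq' a r)) (by omega)
  · simp; omega

theorem cons {f : α → β} {g : α → List β} (hf : PT f) (hg : PT g) : PT (fun a => f a :: g a) :=
  (of_flat_eq fun _ => rfl : PT (fun p : β × List β => p.1 :: p.2)).comp (hf.pair hg)

theorem tail : PT (fun l : List α => l.tail) := by
  refine ⟨pop .m fun o => if o = some (Sym.bit true) then drop else push .m (Sym.bit false),
    8 * Polynomial.X + 10, fun l r => ?_⟩
  cases l with
  | nil => exact Runs.mono (runs_pop_m (t := 1) runs_push_m) (by simp)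
  | cons a l =>
    rw [flat_cons, List.cons_append, List.append_assoc]
    refine Runs.mono (runs_pop_m (t := 8 * size a + 3) (runs_drop_flat a (flat l ++ r))) ?_
    simp [size_cons]
    omega

theorem headD (d : α) : PT (fun l : List α => l.headD d) := by
  refine ⟨pop .m fun o => if o = some (Sym.bit true) then seq swap drop else
    pushList .m (flat d), 16 * Polynomial.X + Polynomial.C ((flat d).length + 10), fun l r => ?_⟩
  cases l with
  | nil =>
    have := runs_pushList .m (flat d) (stk r [] [] [])
    rw [update_stk_m] at this
    exact Runs.mono (runs_pop_m (t := (flat d).length + 1) this) (by simp; omega)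
  | cons a l =>
    rw [flat_cons, List.cons_append, List.append_assoc]
    have h := Runs.seq (runs_swap_flat a l r) (runs_drop_flat l _)
    refine Runs.mono (runs_pop_m (t := _) h) ?_
    simp [size_cons]
    omega

theorem isEmpty : PT (fun l : List α => l.isEmpty) := by
  refine ⟨pop .m fun o => if o = some (Sym.bit true) then
    seq drop (seq drop (push .m (Sym.bit false))) else pushList .m (flat true),
    8 * Polynomial.X + 20, fun l r => ?_⟩
  cases l with
  | nil =>
    have := runs_pushList .m (flat true) (stk r [] [] [])
    rw [update_stk_m] at this
    exact Runs.mono (runs_pop_m (t := (flat true).length + 1) this) (by simp [flat_true])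
  | cons a l =>
    rw [flat_cons, List.cons_append, List.append_assoc]
    have h := Runs.seq (runs_drop_flat a (flat l ++ r)) (Runs.seq (runs_drop_flat l r)
      (runs_push_m (x := Sym.bit false)))
    refine Runs.mono (runs_pop_m (t := _) h) ?_
    simp [size_cons]
    omega

/-- The loop that folds the program `p` over a list. -/
def foldLoop (p : Cmd) : Cmd :=
  loop .c fun _ => pop .m fun o => if o = some (Sym.bit true) then
    seq swap (seq nodeBelow (seq swap (seq p (seq swap (push .c Sym.endRow))))) else skip

/-- One round replaces the codes of `a :: l` and `s` by those of `l` and `F (a, s)`; the node mark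
inserted below `l` joins `a` and `s` into a pair. The counter mark is renewed only if a node symbol
was read, so the loop stops at the empty list. The intermediate states are folds over prefixes, so
only these need a size bound. -/
theorem runs_foldLoop {F : α × β → β} {p : Cmd} {P : Polynomial ℕ}
    (hp : ∀ a r, Runs p (stk (flat a ++ r) [] [] []) (stk (flat (F a) ++ r) [] [] [])
      (P.eval (size a))) (B : ℕ) (r : List Sym) (l : List α) : ∀ s : β, size l ≤ B →
      (∀ l', l' <+: l → size (l'.foldl (fun s a => F (a, s)) s) ≤ B) →
    Runs (foldLoop p) (stk (flat l ++ (flat s ++ r)) [] [] [Sym.endRow])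
      (stk (flat (l.foldl (fun s a => F (a, s)) s) ++ r) [] [] [])
      ((l.length + 1) * (48 * B + 50 + P.eval (2 * B + 1))) := by
  induction l with
  | nil =>
    intro s _ _
    refine Runs.mono (runs_loop_c (t := 2) (t' := 1) ?_ (Runs.loop_nil rfl)) ?_
    · exact runs_pop_m (Runs.skip _)
    · simp; omega
  | cons a l ih =>
    intro s hl hs
    have hs0 := hs [] List.nil_prefix
    have hs1 : size (F (a, s)) ≤ B := hs [a] ⟨l, rfl⟩
    have ih' := ih (F (a, s)) (by rw [size_cons] at hl; omega) fun l' hl' =>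
      hs (a :: l') (List.cons_prefix_cons.2 ⟨rfl, hl'⟩)
    rw [flat_cons, List.cons_append, List.append_assoc]
    have h1 := runs_swap_flat a l (flat s ++ r)
    have h2 := runs_nodeBelow_flat l (flat a ++ (flat s ++ r))
    have h3 := runs_swap_flat l (a, s) r
    have h4 := hp (a, s) (flat l ++ r)
    have h5 := runs_swap_flat (F (a, s)) l r
    simp only [flat_pair, List.cons_append, List.append_assoc] at h3
    simp only [flat_pair, List.cons_append, List.append_assoc] at h4
    refine Runs.mono (runs_loop_c (runs_pop_m (Runs.seq h1 (Runs.seq h2 (Runs.seq h3 (Runs.seq h4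
      (Runs.seq h5 runs_push_c)))))) ih') ?_
    rw [List.foldl_nil] at hs0
    rw [size_cons] at hl
    have h6 : P.eval (size (a, s)) ≤ P.eval (2 * B + 1) :=
      eval_mono P (by rw [size_pair]; omega)
    have h7 := size_pair a s
    rw [List.length_cons, add_mul (l.length + 1)]
    omega

theorem foldl_aux {l : γ → List α} {s : γ → β} {F : α × β → β} (hl : PT l) (hs : PT s)
    (hF : PT F) (Q : Polynomial ℕ)
    (hQ : ∀ c l', l' <+: l c → size (l'.foldl (fun s a => F (a, s)) (s c)) ≤ Q.eval (size c)) :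
    PT (fun c => (l c).foldl (fun s a => F (a, s)) (s c)) := by
  obtain ⟨L, hL⟩ := hl.size_le
  obtain ⟨p₀, P₀, h₀⟩ := hl.pair hs
  obtain ⟨p, P, hp⟩ := hF
  refine ⟨seq p₀ (pop .m fun _ => seq (push .c Sym.endRow) (foldLoop p)),
    P₀ + (L + 1) * (48 * (Q + L) + 50 + P.comp (2 * (Q + L) + 1)) + 2, fun c r => ?_⟩
  have h1 := runs_foldLoop hp (Q.eval (size c) + L.eval (size c)) r (l c) (s c)
    ((hL c).trans (by omega)) fun l' hl' => (hQ c l' hl').trans (by omega)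
  have h0 := h₀ c r
  rw [flat_pair, List.cons_append, List.append_assoc] at h0
  refine Runs.mono (Runs.seq h0 (runs_pop_m (Runs.seq runs_push_c h1))) ?_
  have h2 := hL c
  have h3 := length_lt_size (l c)
  simp only [Polynomial.eval_add, Polynomial.eval_mul, Polynomial.eval_comp,
    Polynomial.eval_ofNat, Polynomial.eval_one]
  have : ((l c).length + 1) * (48 * (Q.eval (size c) + L.eval (size c)) + 50 +
      P.eval (2 * (Q.eval (size c) + L.eval (size c)) + 1)) ≤ (L.eval (size c) + 1) *
      (48 * (Q.eval (size c) + L.eval (size c)) + 50 +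
      P.eval (2 * (Q.eval (size c) + L.eval (size c)) + 1)) :=
    Nat.mul_le_mul_right _ (by omega)
  omega

/-- Folding over a list, with a polynomial bound on the size of the intermediate values. -/
theorem foldl {l : γ → List α} {s : γ → β} {F : γ × α × β → β} (hl : PT l) (hs : PT s)
    (hF : PT F) (Q : Polynomial ℕ)
    (hQ : ∀ c l', l' <+: l c → size (l'.foldl (fun s a => F (c, a, s)) (s c)) ≤
      Q.eval (size c)) :
    PT (fun c => (l c).foldl (fun s a => F (c, a, s)) (s c)) := by
  -- The parameter `c` travels inside the state, because the looped program sees only the current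
  -- element and the state.
  have key : ∀ c (l' : List α) (t : β),
      l'.foldl (fun (s : γ × β) a => ((s.1, F (s.1, a, s.2)) : γ × β)) (c, t) =
        (c, l'.foldl (fun s a => F (c, a, s)) t) := by
    intro c l'
    induction l' with
    | nil => intro t; rfl
    | cons a l' ih => intro t; exact ih _
  have hF' : PT (fun p : α × γ × β => (p.2.1, F (p.2.1, p.1, p.2.2))) :=
    (fst.comp snd).pair (hF.comp ((fst.comp snd).pair (fst.pair (snd.comp snd))))
  have := foldl_aux hl (id.pair hs) hF' (Polynomial.X + Q + 1) (fun c l' hl' => by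
    have := hQ c l' hl'
    simp only [key, size_pair]
    simp
    omega)
  refine (snd.comp this).of_eq fun c => ?_
  simp only [key]

/-- Folding over a list, with a polynomial bound on the growth of a measure that bounds the size
of the intermediate values. -/
theorem foldl_of_growth {l : γ → List α} {s : γ → β} {F : γ × α × β → β} (hl : PT l) (hs : PT s)
    (hF : PT F) (μ : β → ℕ) (R Q₀ Q : Polynomial ℕ) (hR : ∀ t, size t ≤ R.eval (μ t))
    (h₀ : ∀ c, μ (s c) ≤ Q₀.eval (size c))
    (hQ : ∀ c, ∀ a ∈ l c, ∀ t, μ (F (c, a, t)) ≤ μ t + Q.eval (size c)) :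
    PT (fun c => (l c).foldl (fun s a => F (c, a, s)) (s c)) := by
  obtain ⟨L, hL⟩ := hl.size_le
  refine foldl hl hs hF (R.comp (Q₀ + L * Q)) fun c l' hl' => ?_
  have key : ∀ l' : List α, (∀ a ∈ l', a ∈ l c) → ∀ t,
      μ (l'.foldl (fun s a => F (c, a, s)) t) ≤ μ t + l'.length * Q.eval (size c) := by
    intro l'
    induction l' with
    | nil => intro _ t; simp
    | cons a l' ih =>
      intro h t
      have h1 := ih (fun b hb => h b (List.mem_cons_of_mem _ hb)) (F (c, a, t))
      have h2 := hQ c a (h a List.mem_cons_self) t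
      simp only [List.foldl_cons, List.length_cons, add_mul, one_mul]
      omega
  refine (hR _).trans ?_
  rw [Polynomial.eval_comp]
  refine eval_mono R ?_
  have h1 := key l' (fun a ha => hl'.subset ha) (s c)
  have h2 := h₀ c
  have h3 : l'.length * Q.eval (size c) ≤ L.eval (size c) * Q.eval (size c) :=
    Nat.mul_le_mul_right _ (hl'.length_le.trans ((length_lt_size _).le.trans (hL c)))
  simp only [Polynomial.eval_add, Polynomial.eval_mul]
  omega

theorem foldl_of_size {l : γ → List α} {s : γ → β} {F : γ × α × β → β} (hl : PT l) (hs : PT s)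
    (hF : PT F) (Q : Polynomial ℕ)
    (hQ : ∀ c, ∀ a ∈ l c, ∀ t, size (F (c, a, t)) ≤ size t + Q.eval (size c)) :
    PT (fun c => (l c).foldl (fun s a => F (c, a, s)) (s c)) := by
  obtain ⟨Q₀, h₀⟩ := hs.size_le
  exact foldl_of_growth hl hs hF size Polynomial.X Q₀ Q (fun t => by simp) h₀ hQ

end PT

theorem size_list_bool_le (l : List Bool) : size l ≤ 4 * l.length + 1 := by
  induction l with
  | nil => simp [size_nil]
  | cons a l ih =>
    have := size_bool_le a
    rw [size_cons, List.length_cons]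
    omega

theorem size_tail_le {α : Type} [Code α] (l : List α) : size l.tail ≤ size l := by
  cases l with
  | nil => exact le_rfl
  | cons a l => rw [size_cons, List.tail_cons]; omega

namespace PT

variable {α β γ δ : Type} [Code α] [Code β] [Code γ] [Code δ]

theorem not {b : γ → Bool} (hb : PT b) : PT (fun c => !b c) :=
  (hb.cond (const false) (const true)).of_eq fun c => by cases b c <;> rfl

theorem and {b b' : γ → Bool} (hb : PT b) (hb' : PT b') : PT (fun c => b c && b' c) :=
  (hb.cond hb' (const false)).of_eq fun c => by cases b c <;> rfl

theorem beq {b b' : γ → Bool} (hb : PT b) (hb' : PT b') : PT (fun c => b c == b' c) :=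
  (hb.cond hb' hb'.not).of_eq fun c => by cases b c <;> cases b' c <;> rfl

theorem xor {b b' : γ → Bool} (hb : PT b) (hb' : PT b') : PT (fun c => b c ^^ b' c) :=
  (hb.cond hb'.not hb').of_eq fun c => by cases b c <;> cases b' c <;> rfl

theorem foldl_cons {l s : γ → List α} (hl : PT l) (hs : PT s) :
    PT (fun c => (l c).foldl (fun s a => a :: s) (s c)) := by
  obtain ⟨L, hL⟩ := hl.size_le
  refine foldl_of_size (F := fun p : γ × α × List α => p.2.1 :: p.2.2) hl hs
    ((fst.comp snd).cons (snd.comp snd)) (L + 1) fun c a ha t => ?_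
  have h1 := size_le_of_mem ha
  have h2 := hL c
  simp only [size_cons, Polynomial.eval_add, Polynomial.eval_one]
  omega

theorem reverse {l : γ → List α} (hl : PT l) : PT (fun c => (l c).reverse) :=
  (foldl_cons hl (const [])).of_eq fun c => by simp

theorem append {l l' : γ → List α} (hl : PT l) (hl' : PT l') : PT (fun c => l c ++ l' c) :=
  (foldl_cons hl.reverse hl').of_eq fun c => by simp

theorem map {l : γ → List α} {f : γ × α → β} (hl : PT l) (hf : PT f) :
    PT (fun c => (l c).map fun a => f (c, a)) := by
  obtain ⟨L, hL⟩ := hl.size_le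
  obtain ⟨Q, hQ⟩ := hf.size_le
  have h := foldl_of_size (F := fun p : γ × α × List β => f (p.1, p.2.1) :: p.2.2) hl (const [])
    ((hf.comp (fst.pair (fst.comp snd))).cons (snd.comp snd))
    (Q.comp (Polynomial.X + L + 1) + 1) fun c a ha t => by
      have h1 := size_le_of_mem ha
      have h2 := hL c
      have h3 := hQ (c, a)
      have h4 : Q.eval (size (c, a)) ≤ Q.eval (size c + L.eval (size c) + 1) :=
        eval_mono Q (by rw [size_pair]; omega)
      simp only [size_cons, Polynomial.eval_add, Polynomial.eval_one, Polynomial.eval_comp,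
        Polynomial.eval_X]
      omega
  refine h.reverse.of_eq fun c => ?_
  have key : ∀ l s : List β, ∀ k : List α,
      k.foldl (fun s a => f (c, a) :: s) s = (k.map fun a => f (c, a)).reverse ++ s := by
    intro _ s k
    induction k generalizing s with
    | nil => rfl
    | cons a k ih => simp [ih]
  simp [key []]

theorem filter {l : γ → List α} {b : γ × α → Bool} (hl : PT l) (hb : PT b) :
    PT (fun c => (l c).filter fun a => b (c, a)) := by
  obtain ⟨L, hL⟩ := hl.size_le
  have hb' : PT (fun p : γ × α × List α => b (p.1, p.2.1)) := hb.comp (fst.pair (fst.comp snd))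
  have h := foldl_of_size
    (F := fun p : γ × α × List α => bif b (p.1, p.2.1) then p.2.1 :: p.2.2 else p.2.2) hl
    (const []) (hb'.cond ((fst.comp snd).cons (snd.comp snd)) (snd.comp snd)) (L + 1)
    fun c a ha t => by
      have h1 := size_le_of_mem ha
      have h2 := hL c
      cases b (c, a) <;> simp [size_cons]
      omega
  refine h.reverse.of_eq fun c => ?_
  have key : ∀ s : List α, ∀ k : List α,
      k.foldl (fun s a => bif b (c, a) then a :: s else s) s =
        (k.filter fun a => b (c, a)).reverse ++ s := by
    intro s k
    induction k generalizing s with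
    | nil => rfl
    | cons a k ih => cases h : b (c, a) <;> simp [ih, h]
  simp [key]

theorem getD (i : ℕ) (d : α) : PT (fun l : List α => l.getD i d) := by
  induction i with
  | zero => exact (headD d).of_eq fun l => by cases l <;> rfl
  | succ i ih => exact (ih.comp tail).of_eq fun l => by cases l <;> simp

end PT

/-! ### Arithmetic of binary numbers and fractions. -/

/-- Equality of bit strings, by a fold. -/
theorem foldl_beq_bits (a : List Bool) : ∀ (b : List Bool) (o : Bool),
    (fun s : List Bool × Bool => s.2 && s.1.isEmpty) (a.foldl (fun s x =>
      (s.1.tail, s.2 && !s.1.isEmpty && (x == s.1.headD false))) (b, o)) = (o && a == b) := by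
  induction a with
  | nil => intro b o; cases b <;> simp
  | cons x a ih =>
    intro b o
    simp only [List.foldl_cons]
    refine (ih _ _).trans ?_
    cases b <;> simp [Bool.and_assoc]

theorem PT.beq_bits {γ : Type} [Code γ] {f g : γ → List Bool} (hf : PT f) (hg : PT g) :
    PT (fun c => f c == g c) := by
  have hs : PT (fun p : γ × Bool × List Bool × Bool => p.2.2.1) := fst.comp (snd.comp snd)
  have h := foldl_of_size (F := fun p : γ × Bool × List Bool × Bool =>
    (p.2.2.1.tail, p.2.2.2 && !p.2.2.1.isEmpty && (p.2.1 == p.2.2.1.headD false))) hf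
    (hg.pair (const true))
    ((tail.comp hs).pair (((snd.comp (snd.comp snd)).and (isEmpty.comp hs).not).and
      ((fst.comp snd).beq ((headD false).comp hs)))) 3 fun c a _ t => by
        obtain ⟨t, o⟩ := t
        have h1 := size_tail_le t
        have h2 := size_bool_le (o && !t.isEmpty && (a == t.headD false))
        simp only [size_pair, Polynomial.eval_ofNat]
        omega
  exact ((snd.and (isEmpty.comp fst)).comp h).of_eq fun c => by
    simpa using foldl_beq_bits (f c) (g c) true

/-- The number with the given binary digits, the lowest one first. -/
def val : List Bool → ℕ
  | [] => 0
  | b :: l => b.toNat + 2 * val l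

/-- The pairs of digits of two numbers, the shorter one padded by zeros. -/
def zipPad : List Bool → List Bool → List (Bool × Bool)
  | [], b => b.map fun y => (false, y)
  | x :: a, b => (x, b.headD false) :: zipPad a b.tail

theorem length_zipPad (a : List Bool) : ∀ b, (zipPad a b).length = max a.length b.length := by
  induction a with
  | nil => intro b; simp [zipPad]
  | cons x a ih => intro b; cases b <;> simp [zipPad, ih]

theorem val_zipPad_fst (a : List Bool) : ∀ b, val ((zipPad a b).map Prod.fst) = val a := by
  induction a with
  | nil => intro b; induction b <;> simp_all [zipPad, val]
  | cons x a ih => intro b; simp [zipPad, val, ih]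

theorem val_zipPad_snd (a : List Bool) : ∀ b, val ((zipPad a b).map Prod.snd) = val b := by
  induction a with
  | nil => intro b; induction b <;> simp_all [zipPad, val]
  | cons x a ih => intro b; cases b <;> simp [zipPad, val, ih]

theorem foldl_zipPad (a : List Bool) : ∀ (b : List Bool) (o : List (Bool × Bool)),
    (fun s : List Bool × List (Bool × Bool) =>
      (s.1.foldl (fun o y => (false, y) :: o) s.2).reverse)
      (a.foldl (fun s x => (s.1.tail, (x, s.1.headD false) :: s.2)) (b, o)) =
      o.reverse ++ zipPad a b := by
  induction a with
  | nil =>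
    intro b
    induction b with
    | nil => intro o; simp [zipPad]
    | cons y b ih => intro o; simp [zipPad]
  | cons x a ih =>
    intro b o
    simp only [List.foldl_cons]
    refine (ih _ _).trans ?_
    simp [zipPad]

theorem PT.zipPad {γ : Type} [Code γ] {f g : γ → List Bool} (hf : PT f) (hg : PT g) :
    PT (fun c => zipPad (f c) (g c)) := by
  have hs : PT (fun p : γ × Bool × List Bool × List (Bool × Bool) => p.2.2.1) :=
    fst.comp (snd.comp snd)
  have h := foldl_of_size (F := fun p : γ × Bool × List Bool × List (Bool × Bool) =>
    (p.2.2.1.tail, (p.2.1, p.2.2.1.headD false) :: p.2.2.2)) hf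
    (hg.pair (const []))
    ((tail.comp hs).pair (((fst.comp snd).pair ((headD false).comp hs)).cons
      (snd.comp (snd.comp snd)))) 8 fun c a _ t => by
        obtain ⟨t, o⟩ := t
        have h1 := size_tail_le t
        have h2 := size_bool_le a
        have h3 := size_bool_le (t.headD false)
        simp only [size_pair, size_cons, Polynomial.eval_ofNat]
        omega
  have h' := foldl_of_size (F := fun p : (List Bool × List (Bool × Bool)) × Bool ×
      List (Bool × Bool) => (false, p.2.1) :: p.2.2) fst snd
      (((const false).pair (fst.comp snd)).cons (snd.comp snd)) 8 fun c a _ t => by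
        have h2 := size_bool_le a
        have h3 := size_bool_le false
        simp only [size_pair, size_cons, Polynomial.eval_ofNat]
        omega
  exact (h'.reverse.comp h).of_eq fun c => by simpa using foldl_zipPad (f c) (g c) []

/-- Addition of the two numbers given by pairs of digits, and of a carry. -/
def addZip : List (Bool × Bool) → Bool → List Bool
  | [], c => [c]
  | (x, y) :: l, c => (x ^^ y ^^ c) :: addZip l (bif x then (bif y then true else c) else y && c)

theorem val_addZip (l : List (Bool × Bool)) : ∀ c,
    val (addZip l c) = val (l.map Prod.fst) + val (l.map Prod.snd) + c.toNat := by
  induction l with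
  | nil => intro c; simp [addZip, val]
  | cons p l ih =>
    obtain ⟨x, y⟩ := p
    intro c
    simp only [addZip, val, ih, List.map_cons]
    cases x <;> cases y <;> cases c <;> simp <;> omega

theorem length_addZip (l : List (Bool × Bool)) : ∀ c, (addZip l c).length = l.length + 1 := by
  induction l with
  | nil => intro c; rfl
  | cons p l ih => intro c; simp [addZip, ih]

theorem foldl_addZip (l : List (Bool × Bool)) : ∀ (c : Bool) (o : List Bool),
    (fun s : Bool × List Bool => (s.1 :: s.2).reverse) (l.foldl (fun s p =>
      (bif p.1 then (bif p.2 then true else s.1) else p.2 && s.1,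
        (p.1 ^^ p.2 ^^ s.1) :: s.2)) (c, o)) = o.reverse ++ addZip l c := by
  induction l with
  | nil => intro c o; simp [addZip]
  | cons p l ih =>
    intro c o
    simp only [List.foldl_cons]
    refine (ih _ _).trans ?_
    simp [addZip]

/-- Addition of binary numbers. -/
def addBits (a b : List Bool) : List Bool := addZip (zipPad a b) false

theorem val_addBits (a b : List Bool) : val (addBits a b) = val a + val b := by
  simp [addBits, val_addZip, val_zipPad_fst, val_zipPad_snd]

theorem length_addBits (a b : List Bool) :
    (addBits a b).length = max a.length b.length + 1 := by
  simp [addBits, length_addZip, length_zipPad]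

theorem PT.addBits {γ : Type} [Code γ] {f g : γ → List Bool} (hf : PT f) (hg : PT g) :
    PT (fun c => addBits (f c) (g c)) := by
  have hx : PT (fun p : γ × (Bool × Bool) × Bool × List Bool => p.2.1.1) :=
    fst.comp (fst.comp snd)
  have hy : PT (fun p : γ × (Bool × Bool) × Bool × List Bool => p.2.1.2) :=
    snd.comp (fst.comp snd)
  have hc : PT (fun p : γ × (Bool × Bool) × Bool × List Bool => p.2.2.1) :=
    fst.comp (snd.comp snd)
  have h := foldl_of_size (F := fun p : γ × (Bool × Bool) × Bool × List Bool =>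
    (bif p.2.1.1 then (bif p.2.1.2 then true else p.2.2.1) else p.2.1.2 && p.2.2.1,
        (p.2.1.1 ^^ p.2.1.2 ^^ p.2.2.1) :: p.2.2.2)) (hf.zipPad hg)
    ((const false).pair (const []))
    ((hx.cond (hy.cond (const true) hc) (hy.and hc)).pair
      (((hx.xor hy).xor hc).cons (snd.comp (snd.comp snd)))) 7 fun c a _ t => by
        obtain ⟨t, o⟩ := t
        have h2 := size_bool_le (bif a.1 then (bif a.2 then true else t) else a.2 && t)
        have h3 := size_bool_le (a.1 ^^ a.2 ^^ t)
        simp only [size_pair, size_cons, Polynomial.eval_ofNat]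
        omega
  exact ((fst.cons snd).reverse.comp h).of_eq fun c => by
    simpa [MinRepair.addBits] using foldl_addZip (MinRepair.zipPad (f c) (g c)) false []

/-- Comparison of the two numbers given by pairs of digits. -/
def ltZip (l : List (Bool × Bool)) (r : Bool) : Bool :=
  l.foldl (fun r p => bif p.1 == p.2 then r else p.2) r

/-- Digits come lowest first: a differing pair overrides the verdict `r` on the lower digits, an
equal pair keeps it. An initial verdict `true` makes a tie count as less, whence the summand
`r.toNat`. -/
theorem ltZip_iff (l : List (Bool × Bool)) : ∀ r,
    ltZip l r = true ↔ val (l.map Prod.fst) < val (l.map Prod.snd) + r.toNat := by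
  induction l with
  | nil => intro r; cases r <;> simp [ltZip, val]
  | cons p l ih =>
    obtain ⟨x, y⟩ := p
    intro r
    have := ih (bif x == y then r else y)
    simp only [ltZip, List.foldl_cons] at this ⊢
    rw [this]
    cases x <;> cases y <;> cases r <;> simp [val] <;> omega

/-- Comparison of binary numbers. -/
def ltBits (a b : List Bool) : Bool := ltZip (zipPad a b) false

theorem ltBits_iff (a b : List Bool) : ltBits a b = true ↔ val a < val b := by
  simp [ltBits, ltZip_iff, val_zipPad_fst, val_zipPad_snd]

theorem PT.ltBits {γ : Type} [Code γ] {f g : γ → List Bool} (hf : PT f) (hg : PT g) :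
    PT (fun c => ltBits (f c) (g c)) := by
  have hx : PT (fun p : γ × (Bool × Bool) × Bool => p.2.1.1) := fst.comp (fst.comp snd)
  have hy : PT (fun p : γ × (Bool × Bool) × Bool => p.2.1.2) := snd.comp (fst.comp snd)
  exact foldl_of_size (F := fun p : γ × (Bool × Bool) × Bool =>
    bif p.2.1.1 == p.2.1.2 then p.2.2 else p.2.1.2) (hf.zipPad hg) (const false)
    ((hx.beq hy).cond (snd.comp snd) hy) 3 fun c a _ t => by
      have h2 := size_bool_le (bif a.1 == a.2 then t else a.2)
      simp only [Polynomial.eval_ofNat]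
      omega

/-- Multiplication of binary numbers. -/
def mulBits : List Bool → List Bool → List Bool
  | [], _ => []
  | x :: a, b => addBits (false :: mulBits a b) (bif x then b else [])

theorem val_mulBits (a b : List Bool) : val (mulBits a b) = val a * val b := by
  induction a with
  | nil => simp [mulBits, val]
  | cons x a ih => cases x <;> simp [mulBits, val, val_addBits, ih] <;> ring

/-- The coefficient one of `b.length` matters: an accumulator used as second factor grows only
additively under repeated multiplication, as `PT.foldl_of_growth` requires. -/
theorem length_mulBits_le (a b : List Bool) :
    (mulBits a b).length ≤ b.length + 2 * a.length := by
  induction a with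
  | nil => simp [mulBits]
  | cons x a ih => cases x <;> simp [mulBits, length_addBits] <;> omega

theorem mulBits_eq_foldl (a b : List Bool) : mulBits a b =
    a.reverse.foldl (fun s x => addBits (false :: s) (bif x then b else [])) [] := by
  induction a with
  | nil => rfl
  | cons x a ih => simp [mulBits, ih]

theorem PT.mulBits {γ : Type} [Code γ] {f g : γ → List Bool} (hf : PT f) (hg : PT g) :
    PT (fun c => mulBits (f c) (g c)) := by
  obtain ⟨Q, hQ⟩ := hg.size_le
  have h := foldl_of_growth (F := fun p : γ × Bool × List Bool =>
    MinRepair.addBits (false :: p.2.2) (bif p.2.1 then g p.1 else [])) hf.reverse (const [])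
    (((const false).cons (snd.comp snd)).addBits
      ((fst.comp snd).cond (hg.comp fst) (const []))) List.length (4 * Polynomial.X + 1) 0 (Q + 2)
    (fun t => by simpa using size_list_bool_le t) (fun c => by simp) fun c a _ t => by
      have h1 := hQ c
      have h2 := length_lt_size (g c)
      cases a <;> simp [length_addBits] <;> omega
  exact h.of_eq fun c => (mulBits_eq_foldl (f c) (g c)).symm

/-- The sum of fractions, each given by a numerator and a denominator. -/
def sumFrac (l : List (List Bool × List Bool)) : List Bool × List Bool :=
  l.foldl (fun s p => (addBits (mulBits p.2 s.1) (mulBits p.1 s.2), mulBits p.2 s.2)) ([], [true])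

/-- The value of a fraction. -/
def fracVal (p : List Bool × List Bool) : ℚ≥0 := (val p.1 : ℚ≥0) / val p.2

/-- Fractions are never reduced. Denominators multiply, hence remain positive, and this keeps the
usual addition formula valid throughout the fold. -/
theorem sumFrac_spec (l : List (List Bool × List Bool)) (hl : ∀ p ∈ l, 0 < val p.2) :
    0 < val (sumFrac l).2 ∧ fracVal (sumFrac l) = (l.map fracVal).sum := by
  have key : ∀ (l : List (List Bool × List Bool)), (∀ p ∈ l, 0 < val p.2) →
      ∀ s : List Bool × List Bool, 0 < val s.2 →
      let s' := l.foldl (fun s p => (addBits (mulBits p.2 s.1) (mulBits p.1 s.2), mulBits p.2 s.2)) s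
      0 < val s'.2 ∧ fracVal s' = fracVal s + (l.map fracVal).sum := by
    intro l
    induction l with
    | nil => intro _ s hs; simpa using hs
    | cons p l ih =>
      intro hl s hs
      have hp := hl p List.mem_cons_self
      have h0 : 0 < val (mulBits p.2 s.2) := by rw [val_mulBits]; positivity
      obtain ⟨h1, h2⟩ := ih (fun q hq => hl q (List.mem_cons_of_mem _ hq))
        (addBits (mulBits p.2 s.1) (mulBits p.1 s.2), mulBits p.2 s.2) h0
      refine ⟨h1, ?_⟩
      simp only [List.foldl_cons, h2, List.map_cons, List.sum_cons, ← add_assoc]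
      congr 1
      have hp' : (val p.2 : ℚ≥0) ≠ 0 := by exact_mod_cast hp.ne'
      have hs' : (val s.2 : ℚ≥0) ≠ 0 := by exact_mod_cast hs.ne'
      simp only [fracVal, val_addBits, val_mulBits]
      push_cast
      field_simp
  obtain ⟨h1, h2⟩ := key l hl ([], [true]) (by simp [val])
  exact ⟨h1, h2.trans (by simp [fracVal, val])⟩

theorem PT.sumFrac {γ : Type} [Code γ] {f : γ → List (List Bool × List Bool)} (hf : PT f) :
    PT (fun c => sumFrac (f c)) := by
  obtain ⟨Q, hQ⟩ := hf.size_le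
  have hn : PT (fun p : γ × (List Bool × List Bool) × (List Bool × List Bool) => p.2.1.1) :=
    fst.comp (fst.comp snd)
  have hd : PT (fun p : γ × (List Bool × List Bool) × (List Bool × List Bool) => p.2.1.2) :=
    snd.comp (fst.comp snd)
  have hn' : PT (fun p : γ × (List Bool × List Bool) × (List Bool × List Bool) => p.2.2.1) :=
    fst.comp (snd.comp snd)
  have hd' : PT (fun p : γ × (List Bool × List Bool) × (List Bool × List Bool) => p.2.2.2) :=
    snd.comp (snd.comp snd)
  exact foldl_of_growth
    (F := fun p : γ × (List Bool × List Bool) × (List Bool × List Bool) =>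
      (MinRepair.addBits (MinRepair.mulBits p.2.1.2 p.2.2.1) (MinRepair.mulBits p.2.1.1 p.2.2.2),
        MinRepair.mulBits p.2.1.2 p.2.2.2)) hf (const ([], [true]))
    (((hd.mulBits hn').addBits (hn.mulBits hd')).pair (hd.mulBits hd'))
    -- The factor from the list always comes first in `mulBits`, so the longer of numerator and
    -- denominator gains at most twice the length of a list entry, plus one for the addition.
    (fun s => max s.1.length s.2.length) (8 * Polynomial.X + 3) 1 (2 * Q + 1)
    (fun t => by
      have h1 := size_list_bool_le t.1
      have h2 := size_list_bool_le t.2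
      have : size t = _ := size_pair t.1 t.2
      simp
      omega)
    (fun c => by simp) fun c a ha t => by
      have h1 := size_le_of_mem ha
      have h2 := hQ c
      have h3 : size a = _ := size_pair a.1 a.2
      have h4 := length_lt_size a.1
      have h5 := length_lt_size a.2
      have h6 := length_mulBits_le a.2 t.1
      have h7 := length_mulBits_le a.1 t.2
      have h8 := length_mulBits_le a.2 t.2
      simp [length_addBits]
      omega

/-- Comparison of fractions. -/
def ltFrac (p q : List Bool × List Bool) : Bool := ltBits (mulBits p.1 q.2) (mulBits q.1 p.2)

theorem ltFrac_iff {p q : List Bool × List Bool} (hp : 0 < val p.2) (hq : 0 < val q.2) :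
    ltFrac p q = true ↔ fracVal p < fracVal q := by
  have hp' : (0 : ℚ≥0) < val p.2 := by exact_mod_cast hp
  have hq' : (0 : ℚ≥0) < val q.2 := by exact_mod_cast hq
  rw [ltFrac, ltBits_iff, val_mulBits, val_mulBits, fracVal, fracVal, div_lt_div_iff₀ hp' hq']
  exact_mod_cast Iff.rfl

theorem PT.ltFrac {γ : Type} [Code γ] {f g : γ → List Bool × List Bool} (hf : PT f) (hg : PT g) :
    PT (fun c => ltFrac (f c) (g c)) :=
  ((fst.comp hf).mulBits (snd.comp hg)).ltBits ((fst.comp hg).mulBits (snd.comp hf))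

theorem val_encodeNat (n : ℕ) : val (Computability.encodeNat n) = n := by
  have h : ∀ p : PosNum, val (Computability.encodePosNum p) = p := by
    intro p
    induction p with
    | one => simp [Computability.encodePosNum, val]
    | bit0 p ih => simp [Computability.encodePosNum, val, ih]; omega
    | bit1 p ih => simp [Computability.encodePosNum, val, ih]; omega
  unfold Computability.encodeNat
  rw [show (n : ℕ) = (((n : Num) : Num) : ℕ) from (Num.to_of_nat n).symm]
  generalize (n : Num) = k
  rw [Num.of_to_nat]
  cases k with
  | zero => simp [Computability.encodeNum, val]
  | pos p => simp [Computability.encodeNum, h]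


/-! ### Input and output of the machines. -/

/-- A symbol as a pair of truth values, the first of which tells whether it is a bit. -/
def Sym.toPair : Sym → Bool × Bool
  | .bit b => (true, b)
  | .endField => (false, false)
  | .endRow => (false, true)

/-- The symbol given by a pair of truth values. -/
def Sym.ofPair (x y : Bool) : Sym := bif x then .bit y else bif y then .endRow else .endField

theorem Sym.ofPair_toPair (s : Sym) : Sym.ofPair s.toPair.1 s.toPair.2 = s := by
  cases s <;> rfl

instance : Code Sym := ⟨fun s => Code.code s.toPair⟩

theorem flat_sym (s : Sym) :
    flat s = Sym.bit true :: (flat s.toPair.1 ++ flat s.toPair.2) := rfl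

theorem size_sym_le (s : Sym) : size s ≤ 7 := by
  have h1 := size_bool_le s.toPair.1
  have h2 := size_bool_le s.toPair.2
  have : size s = _ := size_pair s.toPair.1 s.toPair.2
  omega

namespace PT

variable {α β γ δ : Type} [Code α] [Code β] [Code γ] [Code δ]

theorem toPair : PT Sym.toPair := of_flat_eq fun _ => rfl

theorem ofPair {f g : γ → Bool} (hf : PT f) (hg : PT g) :
    PT (fun c => Sym.ofPair (f c) (g c)) := by
  have h : ∀ s : Sym, PT (fun _ : γ => s) := const
  refine (hf.cond (hg.cond (h (.bit true)) (h (.bit false)))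
    (hg.cond (h .endRow) (h .endField))).of_eq fun c => ?_
  cases f c <;> cases g c <;> rfl

theorem flatMap {l : γ → List α} {f : γ × α → List β} (hl : PT l) (hf : PT f) :
    PT (fun c => (l c).flatMap fun a => f (c, a)) := by
  obtain ⟨L, hL⟩ := hl.size_le
  obtain ⟨Q, hQ⟩ := hf.size_le
  have h := foldl_of_size (F := fun p : γ × α × List β => p.2.2 ++ f (p.1, p.2.1)) hl (const [])
    ((snd.comp snd).append (hf.comp (fst.pair (fst.comp snd))))
    (Q.comp (Polynomial.X + L + 1)) fun c a ha t => by
      have h1 := size_le_of_mem ha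
      have h2 := hL c
      have h3 := hQ (c, a)
      have h4 : Q.eval (size (c, a)) ≤ Q.eval (size c + L.eval (size c) + 1) :=
        eval_mono Q (by rw [size_pair]; omega)
      have h5 := size_append t (f (c, a))
      simp only [Polynomial.eval_add, Polynomial.eval_one, Polynomial.eval_comp,
        Polynomial.eval_X]
      omega
  refine h.of_eq fun c => ?_
  have key : ∀ (k : List α) (s : List β),
      k.foldl (fun s a => s ++ f (c, a)) s = s ++ k.flatMap fun a => f (c, a) := by
    intro k
    induction k with
    | nil => intro s; simp
    | cons a k ih => intro s; simp [ih]
  simp [key]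

theorem take (n : ℕ) : PT (fun l : List α => l.take n) := by
  induction n with
  | zero => exact (const []).of_eq fun l => by simp
  | succ n ih =>
    -- `headD` needs a default value; over an empty type every list is empty and the identity will
    -- do.
    by_cases h : Nonempty α
    · obtain ⟨d⟩ := h
      exact (isEmpty.cond (const []) ((headD d).cons (ih.comp tail))).of_eq fun l => by
        cases l <;> simp
    · exact id.of_eq fun l => by
        cases l with
        | nil => rfl
        | cons a l => exact absurd ⟨a⟩ h

end PT

/-- Read the input from the stack `a` and put its code, in reverse order, on the main stack. -/
def Cmd.readInput : Cmd :=
  seq (push .m (Sym.bit false)) (loop .a fun x => pushList .m (Sym.bit true :: flat x))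

theorem Cmd.runs_readInput (w : List Sym) :
    Runs readInput (stk [] w [] []) (stk (flat w.reverse) [] [] []) (10 * w.length + 2) := by
  have key : ∀ w l : List Sym, Runs (loop .a fun x => pushList .m (Sym.bit true :: flat x))
      (stk (flat l) w [] []) (stk (flat (w.reverse ++ l)) [] [] []) (10 * w.length + 1) := by
    intro w
    induction w with
    | nil => intro l; exact Runs.loop_nil rfl
    | cons x w ih =>
      intro l
      have h1 := runs_pushList .m (Sym.bit true :: flat x) (stk (flat l) w [] [])
      simp only [update_stk_m, stk_m, List.cons_append] at h1
      have h2 := ih (x :: l)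
      rw [flat_cons] at h2
      rw [List.reverse_cons, List.append_assoc, List.singleton_append]
      refine Runs.mono (runs_loop_a h1 h2) ?_
      have := size_sym_le x
      rw [← length_flat] at this
      simp only [List.length_cons]
      omega
  have := Runs.seq (runs_push_m (x := Sym.bit false)) (key w [])
  rw [List.append_nil] at this
  exact Runs.mono this (by omega)

/-- Pop the code of a truth value from the main stack and continue accordingly. -/
def Cmd.popBool (k : Bool → Cmd) : Cmd :=
  pop .m fun o => if o = some (Sym.bit true) then pop .m fun _ => pop .m fun _ => k true
    else k false

theorem Cmd.runs_popBool {k : Bool → Cmd} {x : Bool} {r a b c : List Sym} {S : Stk → List Sym}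
    {t : ℕ} (h : Runs (k x) (stk r a b c) S t) :
    Runs (popBool k) (stk (flat x ++ r) a b c) S (t + 3) := by
  cases x with
  | true => exact runs_pop_m (t := t + 2) (runs_pop_m (runs_pop_m h))
  | false => exact Runs.mono (runs_pop_m (t := t) h) (by omega)

/-- Write the list on the main stack to the stack `b`, in reverse order. -/
def Cmd.writeOutput : Cmd :=
  seq (push .c Sym.endRow) (loop .c fun _ => pop .m fun o => if o = some (Sym.bit true) then
    pop .m fun _ => popBool fun x => popBool fun y =>
      seq (push .b (Sym.ofPair x y)) (push .c Sym.endRow) else skip)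

theorem Cmd.runs_writeOutput (w : List Sym) :
    Runs writeOutput (stk (flat w) [] [] []) (stk [] [] w.reverse []) (11 * w.length + 5) := by
  have key : ∀ w b : List Sym, Runs (loop .c fun _ => pop .m fun o =>
      if o = some (Sym.bit true) then
      pop .m fun _ => popBool fun x => popBool fun y =>
      seq (push .b (Sym.ofPair x y)) (push .c Sym.endRow) else skip)
      (stk (flat w) [] b [Sym.endRow]) (stk [] [] (w.reverse ++ b) []) (11 * w.length + 4) := by
    intro w
    induction w with
    | nil =>
      intro b
      refine Runs.mono (runs_loop_c (t := 2) (t' := 1) ?_ (Runs.loop_nil rfl)) (by simp)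
      exact runs_pop_m (Runs.skip _)
    | cons x w ih =>
      intro b
      rw [flat_cons, flat_sym, List.cons_append, List.append_assoc, List.reverse_cons,
        List.append_assoc, List.singleton_append]
      refine Runs.mono (runs_loop_c (t := 10) ?_ (ih (x :: b))) (by simp; omega)
      refine runs_pop_m (t := 9) (runs_pop_m (t := 8) (runs_popBool (t := 5)
        (runs_popBool (t := 2) ?_)))
      have := Runs.seq (runs_push_b (m := flat w) (a := []) (b := b) (c := [])
        (x := Sym.ofPair x.toPair.1 x.toPair.2)) (runs_push_c (x := Sym.endRow))
      rwa [Sym.ofPair_toPair] at this ⊢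
  have := Runs.seq (runs_push_c (x := Sym.endRow)) (key w [])
  rw [List.append_nil] at this
  exact Runs.mono this (by omega)

/-- A function whose action on encodings is given by a function that is computed in polynomial
time. -/
theorem PT.computableInPolyTime {α β : Type} {ea : α → List Sym} {eb : β → List Sym} {f : α → β}
    {g : List Sym → List Sym} (hg : PT g)
    (h : ∀ x, g (ea x).reverse = (eb (f x)).reverse) :
    Nonempty (Turing.TM2ComputableInPolyTime ea eb f) := by
  obtain ⟨Q, hQ⟩ := hg.size_le
  obtain ⟨p, P, hp⟩ := hg
  -- Reading and writing each reverse their list, which accounts for both reversals in `h`.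
  refine Cmd.computableInPolyTime (seq readInput (seq p writeOutput))
    (10 * Polynomial.X + (P + 11 * Q).comp (8 * Polynomial.X + 1) + 7) fun x => ?_
  have h1 := hp (ea x).reverse []
  have h2 := runs_writeOutput (g (ea x).reverse)
  rw [List.append_nil, List.append_nil] at h1
  have h3 := Runs.seq (runs_readInput (ea x)) (Runs.seq h1 h2)
  rw [h, List.reverse_reverse] at h3
  refine Runs.mono h3 ?_
  have h4 : ∀ w : List Sym, size w ≤ 8 * w.length + 1 := by
    intro w
    induction w with
    | nil => simp [size_nil]
    | cons a w ih =>
      have := size_sym_le a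
      rw [size_cons, List.length_cons]
      omega
  have h5 := h4 (ea x).reverse
  rw [List.length_reverse] at h5
  have h6 := eval_mono P h5
  have h7 := eval_mono Q h5
  have h8 := hQ (ea x).reverse
  have h9 := length_lt_size (g (ea x).reverse)
  rw [h] at h8 h9
  simp only [Polynomial.eval_add, Polynomial.eval_mul, Polynomial.eval_comp,
    Polynomial.eval_ofNat, Polynomial.eval_one, Polynomial.eval_X] at *
  omega

/-! ### Parsing and unparsing of instances. -/

/-- Reading one more symbol, from the right, of an encoded list of rows. -/
def parseStep : Sym → List (List (List Bool)) → List (List (List Bool))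
  | .bit b, rows =>
    ((b :: (rows.headD []).headD []) :: (rows.headD []).tail) :: rows.tail
  | .endField, rows => ([] :: rows.headD []) :: rows.tail
  | .endRow, rows => [] :: rows

/-- The rows, as lists of fields, of an encoded list of rows. -/
def parse (w : List Sym) : List (List (List Bool)) := w.foldr parseStep []

/-- `parseStep` puts material of the old head inside the new head `x`. Keeping the old head on the
left lets its size cancel against its share in `size x`, so that a step adds only a constant. -/
theorem size_cons_tail_le {α : Type} [Code α] (x d : α) (l : List α) :
    size (x :: l.tail) + size (l.headD d) ≤ size x + size l + size d + 1 := by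
  cases l with
  | nil => simp [size_cons, size_nil]; omega
  | cons a l => simp [size_cons]; omega

theorem size_parseStep_le (s : Sym) (rows : List (List (List Bool))) :
    size (parseStep s rows) ≤ size rows + 20 := by
  have h0 : size ([] : List (List Bool)) = 1 := rfl
  have h0' : size ([] : List Bool) = 1 := rfl
  cases s with
  | bit b =>
    have h1 := size_cons_tail_le ((b :: (rows.headD []).headD []) :: (rows.headD []).tail) [] rows
    have h2 := size_cons_tail_le (b :: (rows.headD []).headD []) [] (rows.headD [])
    have h3 := size_cons b ((rows.headD []).headD [])
    have h4 := size_bool_le b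
    rw [parseStep]
    omega
  | endField =>
    have h1 := size_cons_tail_le ([] :: rows.headD []) [] rows
    have h2 := size_cons ([] : List Bool) (rows.headD [])
    rw [parseStep]
    omega
  | endRow =>
    rw [parseStep, size_cons]
    omega

theorem PT.parse_reverse : PT (fun w : List Sym => parse w.reverse) := by
  have hb : PT (fun p : List Sym × Sym × List (List (List Bool)) => p.2.1.toPair.1) :=
    fst.comp (toPair.comp (fst.comp snd))
  have hb' : PT (fun p : List Sym × Sym × List (List (List Bool)) => p.2.1.toPair.2) :=
    snd.comp (toPair.comp (fst.comp snd))
  have hr : PT (fun p : List Sym × Sym × List (List (List Bool)) => p.2.2) := snd.comp snd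
  have hh := (headD (α := List (List Bool)) []).comp hr
  have hF : PT (fun p : List Sym × Sym × List (List (List Bool)) => parseStep p.2.1 p.2.2) := by
    refine (hb.cond (((hb'.cons ((headD []).comp hh)).cons (tail.comp hh)).cons (tail.comp hr))
      (hb'.cond ((const []).cons hr) (((const []).cons hh).cons (tail.comp hr)))).of_eq
      fun p => ?_
    rcases p with ⟨_, s, rows⟩
    cases s <;> rfl
  refine (foldl_of_size (F := fun p : List Sym × Sym × List (List (List Bool)) =>
    parseStep p.2.1 p.2.2) id (const []) hF 20 fun c a _ t => ?_).of_eq fun w => ?_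
  · simpa using size_parseStep_le a t
  · simp [parse, List.foldr_reverse]

/-- Scanned from the right, the mark precedes the bits it terminates: it opens an empty field in the
current row, and the bits are then prepended to that field. -/
theorem foldr_parseStep_field (f : List Bool) {w : List Sym} {r : List (List Bool)}
    {rows : List (List (List Bool))} (h : parse w = r :: rows) :
    parse (encodeField f ++ w) = (f :: r) :: rows := by
  unfold parse at *
  induction f with
  | nil => simp [encodeField, h, parseStep]
  | cons b f ih =>
    simp only [encodeField, List.map_cons, List.cons_append, List.foldr_cons] at ih ⊢
    rw [ih]
    rfl

theorem parse_fields (fs : List (List Bool)) {w : List Sym} {r : List (List Bool)}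
    {rows : List (List (List Bool))} (h : parse w = r :: rows) :
    parse (fs.flatMap encodeField ++ w) = (fs ++ r) :: rows := by
  induction fs with
  | nil => simpa using h
  | cons f fs ih =>
    rw [List.flatMap_cons, List.append_assoc]
    exact foldr_parseStep_field f ih

theorem parse_rows (l : List (List (List Bool))) :
    parse (l.flatMap fun fs => fs.flatMap encodeField ++ [Sym.endRow]) = l := by
  induction l with
  | nil => rfl
  | cons fs l ih =>
    rw [List.flatMap_cons, List.append_assoc, List.singleton_append, parse_fields fs (r := [])
      (rows := l), List.append_nil]
    exact congrArg (List.cons []) ih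

/-- The fields of a weighted tuple. -/
def toRow {d : ℕ} {dom : Type} (enc : dom → List Bool) (r : Tuple d dom × ℚ≥0) :
    List (List Bool) :=
  (List.ofFn r.1).map enc ++ [Computability.encodeNat r.2.num, Computability.encodeNat r.2.den]

theorem parse_encodeInstance {d : ℕ} {dom : Type} (enc : dom → List Bool)
    (D : WeightedInstance d dom) : parse (encodeInstance enc D) = D.rows.map (toRow enc) := by
  rw [← parse_rows (D.rows.map (toRow enc))]
  congr 1
  simp [encodeInstance, List.flatMap_map, toRow, encodeTuple, -List.map_ofFn]

/-- The encoding of the first `d` fields of each row. -/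
def unparse (d : ℕ) (rows : List (List (List Bool))) : List Sym :=
  rows.flatMap fun r => (r.take d).flatMap (fun f => f.map Sym.bit ++ [Sym.endField]) ++
    [Sym.endRow]

theorem PT.unparse (d : ℕ) : PT (unparse d) := by
  have h1 : PT (fun f : List Bool => f.map Sym.bit) :=
    map id ((ofPair (const true) snd).of_eq fun p : List Bool × Bool => rfl)
  have h2 : PT (fun f : List Bool => f.map Sym.bit ++ [Sym.endField]) := h1.append (const _)
  have h3 : PT (fun r : List (List Bool) =>
      (r.take d).flatMap fun f => f.map Sym.bit ++ [Sym.endField]) :=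
    flatMap (take d) (h2.comp snd)
  have h4 : PT (fun r : List (List Bool) =>
      (r.take d).flatMap (fun f => f.map Sym.bit ++ [Sym.endField]) ++ [Sym.endRow]) :=
    h3.append (const _)
  exact flatMap id (h4.comp snd)

theorem unparse_toRow {d : ℕ} {dom : Type} (enc : dom → List Bool)
    (l : List (Tuple d dom × ℚ≥0)) :
    unparse d (l.map (toRow enc)) = encodeTuples enc (l.map Prod.fst) := by
  have : ∀ r : Tuple d dom × ℚ≥0, (toRow enc r).take d = (List.ofFn r.1).map enc := fun r => by
    rw [toRow, List.take_left']
    simp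
  simp [unparse, encodeTuples, encodeTuple, List.flatMap_map, this, encodeField, -List.map_ofFn]

/-! ### The repair algorithm on rows of bit strings. -/

/-- Agreement of two rows on some columns. -/
def agreeRow (Z : List ℕ) (s t : List (List Bool)) : Bool :=
  Z.all fun i => s.getD i [] == t.getD i []

/-- Numerator and denominator of the weight in a row with `d` columns for the tuple. -/
def fracRow (d : ℕ) (r : List (List Bool)) : List Bool × List Bool :=
  (r.getD d [], r.getD (d + 1) [])

/-- The total weight of the rows of `E` that agree with `t` on the columns `Z`. -/
def weightRow (d : ℕ) (Z : List ℕ) (E : List (List (List Bool))) (t : List (List Bool)) :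
    List Bool × List Bool :=
  sumFrac ((E.filter fun s => agreeRow Z s t).map fun s => fracRow d s)

/-- Among the rows of `E` that agree with `t` on `Z`, the first one whose class for agreement on
`Z ++ Y` has minimum weight. -/
def bestRow (d : ℕ) (Z Y : List ℕ) (E : List (List (List Bool))) (t : List (List Bool)) :
    List (List Bool) :=
  (E.filter fun s => agreeRow Z s t).foldl (fun c s =>
    bif ltFrac (weightRow d (Z ++ Y) E s) (weightRow d (Z ++ Y) E c) then s else c)
    ((E.filter fun s => agreeRow Z s t).headD [])

/-- Keep in each class for agreement on `Z` a subclass for agreement on `Y` of minimum weight. -/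
def passRow (d : ℕ) (Z Y : List ℕ) (E : List (List (List Bool))) : List (List (List Bool)) :=
  E.filter fun t => agreeRow Y t (bestRow d Z Y E t)

/-- The passes for a list of functional dependencies, the last one first, within the classes for
agreement on `C`. -/
def runRow (d : ℕ) : List (List ℕ × List ℕ) → List ℕ → List (List (List Bool)) →
    List (List (List Bool))
  | [], _, E => E
  | (X, Y) :: l, C, E => passRow d (C ++ X) Y (runRow d l (C ++ X ++ Y) E)

namespace PT

variable {γ : Type} [Code γ] {E : γ → List (List (List Bool))} {s t : γ → List (List Bool)}

theorem agreeRow (Z : List ℕ) (hs : PT s) (ht : PT t) :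
    PT (fun c => agreeRow Z (s c) (t c)) := by
  induction Z with
  | nil => exact const true
  | cons i Z ih =>
    exact ((((getD i []).comp hs).beq_bits ((getD i []).comp ht)).and ih).of_eq fun c => by
      simp [MinRepair.agreeRow]

theorem filter_agreeRow (Z : List ℕ) (hE : PT E) (ht : PT t) :
    PT (fun c => (E c).filter fun s => MinRepair.agreeRow Z s (t c)) :=
  filter (b := fun p : γ × List (List Bool) => MinRepair.agreeRow Z p.2 (t p.1)) hE
    (agreeRow Z snd (ht.comp fst))

theorem weightRow (d : ℕ) (Z : List ℕ) (hE : PT E) (ht : PT t) :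
    PT (fun c => weightRow d Z (E c) (t c)) :=
  (map (f := fun p : γ × List (List Bool) => fracRow d p.2) (filter_agreeRow Z hE ht)
    (((getD d []).pair (getD (d + 1) [])).comp snd)).sumFrac

theorem bestRow (d : ℕ) (Z Y : List ℕ) (hE : PT E) (ht : PT t) :
    PT (fun c => bestRow d Z Y (E c) (t c)) := by
  have hf := filter_agreeRow Z hE ht
  obtain ⟨L, hL⟩ := hf.size_le
  have hE' : PT (fun p : γ × List (List Bool) × List (List Bool) => E p.1) := hE.comp fst
  refine foldl_of_size (F := fun p : γ × List (List Bool) × List (List Bool) =>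
    bif MinRepair.ltFrac (MinRepair.weightRow d (Z ++ Y) (E p.1) p.2.1)
      (MinRepair.weightRow d (Z ++ Y) (E p.1) p.2.2) then p.2.1 else p.2.2) hf
    ((headD []).comp hf)
    (((weightRow d (Z ++ Y) hE' (fst.comp snd)).ltFrac
      (weightRow d (Z ++ Y) hE' (snd.comp snd))).cond (fst.comp snd) (snd.comp snd)) L
    fun c a ha u => ?_
  have h1 := size_le_of_mem ha
  have h2 := hL c
  simp only [Bool.cond_eq_ite]
  split <;> omega

theorem passRow (d : ℕ) (Z Y : List ℕ) (hE : PT E) : PT (fun c => passRow d Z Y (E c)) :=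
  filter (b := fun p : γ × List (List Bool) =>
    MinRepair.agreeRow Y p.2 (MinRepair.bestRow d Z Y (E p.1) p.2)) hE
    (agreeRow Y snd (bestRow d Z Y (hE.comp fst) snd))

theorem runRow (d : ℕ) (l : List (List ℕ × List ℕ)) : ∀ C, PT (runRow d l C) := by
  induction l with
  | nil => intro C; exact id
  | cons p l ih =>
    intro C
    exact passRow d (C ++ p.1) p.2 (ih (C ++ p.1 ++ p.2))

end PT

/-! ### Minimum repairs along a chain of left-hand sides. -/

section Semantics

variable {d : ℕ} {dom : Type}

/-- Agreement of two tuples on some attributes. -/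
def Agree (Z : List (Fin d)) (s t : Tuple d dom) : Prop := ∀ i ∈ Z, s i = t i

theorem Agree.refl (Z : List (Fin d)) (s : Tuple d dom) : Agree Z s s := fun _ _ => rfl

theorem Agree.symm {Z : List (Fin d)} {s t : Tuple d dom} (h : Agree Z s t) : Agree Z t s :=
  fun i hi => (h i hi).symm

theorem Agree.trans {Z : List (Fin d)} {s t u : Tuple d dom} (h : Agree Z s t)
    (h' : Agree Z t u) : Agree Z s u :=
  fun i hi => (h i hi).trans (h' i hi)

theorem agree_append {Z Y : List (Fin d)} {s t : Tuple d dom} :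
    Agree (Z ++ Y) s t ↔ Agree Z s t ∧ Agree Y s t := by
  simp [Agree, or_imp, forall_and]

/-- Satisfaction of a list of functional dependencies. -/
def Sat (l : List (List (Fin d) × List (Fin d))) (I : Finset (Tuple d dom)) : Prop :=
  ∀ p ∈ l, ∀ s ∈ I, ∀ t ∈ I, Agree p.1 s t → Agree p.2 s t

theorem Sat.mono {l : List (List (Fin d) × List (Fin d))} {I J : Finset (Tuple d dom)}
    (h : Sat l J) (hIJ : I ⊆ J) : Sat l I :=
  fun p hp s hs t ht => h p hp s (hIJ hs) t (hIJ ht)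

/-- Subset repairs for a list of functional dependencies. -/
def IsRep (l : List (List (Fin d) × List (Fin d))) (D E : Finset (Tuple d dom)) : Prop :=
  Maximal (fun I => I ⊆ D ∧ Sat l I) E

theorem IsRep.nonempty {l : List (List (Fin d) × List (Fin d))}
    {D E : Finset (Tuple d dom)} (h : IsRep l D E) (hD : D.Nonempty) : E.Nonempty := by
  obtain ⟨c, hc⟩ := hD
  by_contra hE
  rw [Finset.not_nonempty_iff_eq_empty] at hE
  -- A single tuple violates nothing, so the empty set is not maximal.
  have : {c} ⊆ E := h.2 ⟨by simpa using hc, fun p _ s hs t ht _ => by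
    rw [Finset.mem_singleton.1 hs, Finset.mem_singleton.1 ht]
    exact Agree.refl _ _⟩ (by simp [hE])
  simp [hE] at this

variable [DecidableEq dom]

instance (Z : List (Fin d)) (s t : Tuple d dom) : Decidable (Agree Z s t) :=
  inferInstanceAs (Decidable (∀ i ∈ Z, s i = t i))

/-- The tuples of `D` that agree with `t` on `Z`. -/
def cls (Z : List (Fin d)) (t : Tuple d dom) (D : Finset (Tuple d dom)) :
    Finset (Tuple d dom) :=
  D.filter fun s => Agree Z s t

theorem mem_cls {Z : List (Fin d)} {s t : Tuple d dom} {D : Finset (Tuple d dom)} :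
    s ∈ cls Z t D ↔ s ∈ D ∧ Agree Z s t :=
  Finset.mem_filter

theorem cls_subset {Z : List (Fin d)} {t : Tuple d dom} {D : Finset (Tuple d dom)} :
    cls Z t D ⊆ D :=
  Finset.filter_subset _ _

theorem cls_mono {Z : List (Fin d)} {t : Tuple d dom} {D E : Finset (Tuple d dom)} (h : E ⊆ D) :
    cls Z t E ⊆ cls Z t D :=
  Finset.filter_subset_filter _ h

theorem cls_eq_of_agree {Z : List (Fin d)} {s t : Tuple d dom} (h : Agree Z s t)
    (D : Finset (Tuple d dom)) : cls Z s D = cls Z t D := by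
  ext x
  simp only [mem_cls]
  exact and_congr_right fun _ => ⟨fun hx => hx.trans h, fun hx => hx.trans h.symm⟩

theorem cls_cls {Z Y : List (Fin d)} {t v : Tuple d dom} (h : Agree Z v t)
    (D : Finset (Tuple d dom)) : cls Y v (cls Z t D) = cls (Z ++ Y) v D := by
  ext x
  simp only [mem_cls, agree_append, and_assoc]
  exact and_congr_right fun _ => and_congr_left fun _ =>
    ⟨fun hx => hx.trans h.symm, fun hx => hx.trans h⟩

/-- Subset repairs of minimum weight. -/
def IsMinRep (w : Tuple d dom → ℚ≥0) (l : List (List (Fin d) × List (Fin d)))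
    (D E : Finset (Tuple d dom)) : Prop :=
  IsRep l D E ∧ ∀ E', IsRep l D E' → ∑ t ∈ E, w t ≤ ∑ t ∈ E', w t

variable {w : Tuple d dom → ℚ≥0} {l : List (List (Fin d) × List (Fin d))}
  {D E : Finset (Tuple d dom)}

/-- The restriction of a repair to a class is a repair of the class. -/
theorem IsRep.cls {X : List (Fin d)} (hX : ∀ p ∈ l, X ⊆ p.1) (h : IsRep l D E)
    (t : Tuple d dom) : IsRep l (cls X t D) (cls X t E) := by
  refine ⟨⟨cls_mono h.1.1, h.1.2.mono cls_subset⟩, fun J ⟨hJD, hJ⟩ hEJ => ?_⟩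
  -- Tuples that agree on a left-hand side agree on `X`. If one of them is in `J`, both are, since
  -- `J` contains all of `E` in its class; otherwise both are in `E`.
  have hsat : Sat l (E ∪ J) := by
    intro p hp s hs u hu hsu
    have hXsu : Agree X s u := fun i hi => hsu i (hX p hp hi)
    have key : ∀ {x y : Tuple d dom}, x ∈ J → Agree X x y → y ∈ E ∪ J → y ∈ J := by
      intro x y hx hxy hy
      rcases Finset.mem_union.1 hy with hy | hy
      · exact hEJ (mem_cls.2 ⟨hy, hxy.symm.trans (mem_cls.1 (hJD hx)).2⟩)
      · exact hy
    by_cases hsJ : s ∈ J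
    · exact hJ p hp s hsJ u (key hsJ hXsu hu) hsu
    by_cases huJ : u ∈ J
    · exact hJ p hp s (key huJ hXsu.symm hs) u huJ hsu
    · exact h.1.2 p hp s ((Finset.mem_union.1 hs).resolve_right hsJ) u
        ((Finset.mem_union.1 hu).resolve_right huJ) hsu
  have hle := h.2 ⟨Finset.union_subset h.1.1 (hJD.trans cls_subset), hsat⟩
    Finset.subset_union_left
  exact fun x hx => mem_cls.2 ⟨hle (Finset.mem_union_right _ hx), (mem_cls.1 (hJD hx)).2⟩

/-- Minimum repairs of the classes for agreement on attributes common to all left-hand sides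
make up a minimum repair. -/
theorem isMinRep_of_cls {X : List (Fin d)} (hX : ∀ p ∈ l, X ⊆ p.1) (hED : E ⊆ D)
    (h : ∀ t ∈ D, IsMinRep w l (cls X t D) (cls X t E)) : IsMinRep w l D E := by
  refine ⟨⟨⟨hED, fun p hp s hs t ht hst => ?_⟩, fun I ⟨hID, hI⟩ hEI x hx => ?_⟩, fun E' hE' => ?_⟩
  · exact (h t (hED ht)).1.1.2 p hp s (mem_cls.2 ⟨hs, fun i hi => hst i (hX p hp hi)⟩) t
      (mem_cls.2 ⟨ht, Agree.refl _ _⟩) hst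
  · exact (mem_cls.1 ((h x (hID hx)).1.2 ⟨cls_mono hID, hI.mono cls_subset⟩ (cls_mono hEI)
      (mem_cls.2 ⟨hx, Agree.refl _ _⟩))).1
  -- The weights are split along the classes, indexed by the value lists `X.map t`, and compared
  -- class by class.
  · have key : ∀ s t : Tuple d dom, X.map s = X.map t ↔ Agree X s t := fun s t => by
      simp [Agree]
    have hsum : ∀ I ⊆ D, ∑ t ∈ I, w t =
        ∑ k ∈ D.image (fun t => X.map t), ∑ t ∈ I with X.map t = k, w t := fun I hI =>
      (Finset.sum_fiberwise_of_maps_to (fun t ht => Finset.mem_image_of_mem _ (hI ht)) _).symm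
    rw [hsum E hED, hsum E' hE'.1.1]
    refine Finset.sum_le_sum fun k hk => ?_
    obtain ⟨t, ht, rfl⟩ := Finset.mem_image.1 hk
    simp only [key]
    exact (h t ht).2 _ (hE'.cls hX t)

/-- If all tuples agree on `X`, then a lightest one of the minimum repairs of the classes for
agreement on `Y` is a minimum repair that also takes `X → Y` into account. -/
theorem isMinRep_cons {X Y : List (Fin d)} (hD : ∀ s ∈ D, ∀ t ∈ D, Agree X s t)
    {c : Tuple d dom} (hc : c ∈ D) (hE : IsRep l (cls Y c D) E)
    (h : ∀ v ∈ D, ∃ E', IsMinRep w l (cls Y v D) E' ∧ ∑ t ∈ E, w t ≤ ∑ t ∈ E', w t) :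
    IsMinRep w ((X, Y) :: l) D E := by
  have hsat : ∀ {I : Finset (Tuple d dom)} {v : Tuple d dom}, I ⊆ cls Y v D → Sat l I →
      Sat ((X, Y) :: l) I := by
    intro I v hI hs p hp
    rcases List.mem_cons.1 hp with rfl | hp
    · exact fun s hs t ht _ => (mem_cls.1 (hI hs)).2.trans (mem_cls.1 (hI ht)).2.symm
    · exact hs p hp
  have hcls : ∀ {I : Finset (Tuple d dom)} {e : Tuple d dom}, I ⊆ D → Sat ((X, Y) :: l) I →
      e ∈ I → I ⊆ cls Y e D := fun hI hs he x hx =>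
    mem_cls.2 ⟨hI hx, hs _ List.mem_cons_self x hx _ he (hD x (hI hx) _ (hI he))⟩
  have htail : ∀ {I : Finset (Tuple d dom)}, Sat ((X, Y) :: l) I → Sat l I :=
    fun hs p hp => hs p (List.mem_cons_of_mem _ hp)
  refine ⟨⟨⟨hE.1.1.trans cls_subset, hsat hE.1.1 hE.1.2⟩, fun I ⟨hID, hI⟩ hEI => ?_⟩,
    fun E' hE' => ?_⟩
  -- `E` has a tuple `e`, and `X → Y` keeps every consistent extension of `E` inside the block of
  -- `e`, where `E` is already maximal.
  · obtain ⟨e, he⟩ := hE.nonempty ⟨c, mem_cls.2 ⟨hc, Agree.refl _ _⟩⟩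
    have hsub := hcls hID hI (hEI he)
    rw [cls_eq_of_agree (mem_cls.1 (hE.1.1 he)).2] at hsub
    exact hE.2 ⟨hsub, htail hI⟩ hEI
  -- A competitor lies in the block of any of its tuples. Inside a block `X → Y` holds
  -- automatically, so the competitor is a repair of that block for `l`.
  · obtain ⟨e, he⟩ := hE'.nonempty ⟨c, hc⟩
    obtain ⟨E₁, hE₁, hle⟩ := h e (hE'.1.1 he)
    refine hle.trans (hE₁.2 E' ⟨⟨hcls hE'.1.1 hE'.1.2 he, htail hE'.1.2⟩, ?_⟩)
    exact fun I ⟨hI, hIs⟩ hEI => hE'.2 ⟨hI.trans cls_subset, hsat hI hIs⟩ hEI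

/-- In each class of `E` for agreement on `Z`, the set `E'` consists of a subclass for agreement
on `Y` that has minimum weight. -/
def IsPass (w : Tuple d dom → ℚ≥0) (Z Y : List (Fin d)) (E E' : Finset (Tuple d dom)) : Prop :=
  E' ⊆ E ∧ ∀ t ∈ E, ∃ c ∈ E, Agree Z c t ∧
    (∀ s ∈ E, Agree Z s t → ∑ x ∈ cls (Z ++ Y) c E, w x ≤ ∑ x ∈ cls (Z ++ Y) s E, w x) ∧
    ∀ s ∈ E, Agree Z s t → (s ∈ E' ↔ Agree Y s c)

/-- `E` results from `D` by the passes for a list of functional dependencies, the last one first,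
within the classes for agreement on `C`. -/
def IsRun (w : Tuple d dom → ℚ≥0) : List (List (Fin d) × List (Fin d)) → List (Fin d) →
    Finset (Tuple d dom) → Finset (Tuple d dom) → Prop
  | [], _, D, E => E = D
  | (X, Y) :: l, C, D, E => ∃ E', IsRun w l (C ++ X ++ Y) D E' ∧ IsPass w (C ++ X) Y E' E

/-- Induction on the list, `C` collecting the attributes already fixed by the outer dependencies.
Sortedness puts the head's `X` inside every left-hand side, so it suffices to treat the classes for
`C ++ X`. There the induction hypothesis for `C ++ X ++ Y` supplies a minimum repair of every block,
and the pass selects a lightest one. -/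
theorem IsRun.isMinRep (hl : l.Pairwise fun p q => p.1 ⊆ q.1) :
    ∀ {C : List (Fin d)} {E : Finset (Tuple d dom)}, IsRun w l C D E →
      E ⊆ D ∧ ∀ u ∈ D, IsMinRep w l (cls C u D) (cls C u E) := by
  induction l with
  | nil =>
    rintro C E rfl
    have hs : ∀ I : Finset (Tuple d dom), Sat [] I := fun I p hp => absurd hp (by simp)
    refine ⟨subset_rfl, fun u _ => ⟨⟨⟨subset_rfl, hs _⟩, fun I hI _ => hI.1⟩, fun E' hE' => ?_⟩⟩
    exact Finset.sum_le_sum_of_subset (hE'.2 ⟨subset_rfl, hs _⟩ hE'.1.1)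
  | cons p l ih =>
    obtain ⟨X, Y⟩ := p
    rintro C E ⟨E', hrun, hEE', hpass⟩
    obtain ⟨hE'D, hmin⟩ := ih (List.pairwise_cons.1 hl).2 hrun
    refine ⟨hEE'.trans hE'D, fun u _ => ?_⟩
    have hX : ∀ p ∈ (X, Y) :: l, X ⊆ p.1 := by
      intro p hp
      rcases List.mem_cons.1 hp with rfl | hp
      · exact fun _ h => h
      · exact (List.pairwise_cons.1 hl).1 p hp
    have hne : ∀ v ∈ D, (cls (C ++ X ++ Y) v E').Nonempty := fun v hv =>
      (hmin v hv).1.nonempty ⟨v, mem_cls.2 ⟨hv, Agree.refl _ _⟩⟩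
    refine isMinRep_of_cls hX (cls_mono (hEE'.trans hE'D)) fun t ht => ?_
    obtain ⟨htD, htu⟩ := mem_cls.1 ht
    rw [cls_cls htu, cls_cls htu]
    -- The tuple `t` itself may have been removed by the inner passes, but its block retains some
    -- tuple, at which the pass condition can be applied.
    obtain ⟨s₀, hs₀⟩ := hne t htD
    obtain ⟨hs₀E, hs₀t⟩ := mem_cls.1 hs₀
    replace hs₀t := (agree_append.1 hs₀t).1
    obtain ⟨c, hcE, hcs, hcw, hc⟩ := hpass s₀ hs₀E
    have hct := hcs.trans hs₀t
    -- What the pass leaves of the class of `t` is exactly the chosen block, that of `c`.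
    have hEc : cls (C ++ X) t E = cls (C ++ X ++ Y) c E' := by
      ext x
      simp only [mem_cls, agree_append (Z := C ++ X)]
      constructor
      · rintro ⟨hx, hxt⟩
        exact ⟨hEE' hx, hxt.trans hct.symm, (hc x (hEE' hx) (hxt.trans hs₀t.symm)).1 hx⟩
      · rintro ⟨hx, hxc, hxY⟩
        exact ⟨(hc x hx (hxc.trans hcs)).2 hxY, hxc.trans hct⟩
    refine isMinRep_cons (c := c) ?_ (mem_cls.2 ⟨hE'D hcE, hct⟩) ?_ fun v hv => ?_
    · intro s hs s' hs'
      exact (agree_append.1 ((mem_cls.1 hs).2.trans (mem_cls.1 hs').2.symm)).2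
    · rw [cls_cls hct, hEc]
      exact (hmin c (hE'D hcE)).1
    · obtain ⟨hvD, hvt⟩ := mem_cls.1 hv
      refine ⟨_, by rw [cls_cls hvt]; exact hmin v hvD, ?_⟩
      obtain ⟨s, hs⟩ := hne v hvD
      obtain ⟨hsE, hsv⟩ := mem_cls.1 hs
      rw [hEc, ← cls_eq_of_agree hsv]
      exact hcw s hsE (((agree_append.1 hsv).1.trans hvt).trans hs₀t.symm)

end Semantics

/-! ### Correctness of the algorithm on encoded rows. -/

/-- A fold that keeps the better one of two elements finds a minimum. -/
theorem foldl_min {α : Type} (lt : α → α → Bool) (v : α → ℚ≥0) (k : List α) : ∀ a : α,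
    (∀ s ∈ a :: k, ∀ u ∈ a :: k, lt s u = true ↔ v s < v u) →
    k.foldl (fun c s => bif lt s c then s else c) a ∈ a :: k ∧
      ∀ s ∈ a :: k, v (k.foldl (fun c s => bif lt s c then s else c) a) ≤ v s := by
  induction k with
  | nil => intro a _; simp
  | cons b k ih =>
    intro a h
    have hba := h b (by simp) a (by simp)
    rw [List.foldl_cons]
    cases hlt : lt b a with
    | true =>
      obtain ⟨h1, h2⟩ := ih b fun s hs u hu =>
        h s (List.mem_cons_of_mem _ hs) u (List.mem_cons_of_mem _ hu)
      refine ⟨List.mem_cons_of_mem _ h1, fun s hs => ?_⟩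
      rcases List.mem_cons.1 hs with rfl | hs
      · exact (h2 b List.mem_cons_self).trans (hba.1 hlt).le
      · exact h2 s hs
    | false =>
      have hsub : ∀ s ∈ a :: k, s ∈ a :: b :: k := fun s hs => by
        rcases List.mem_cons.1 hs with rfl | hs
        · exact List.mem_cons_self
        · exact List.mem_cons_of_mem _ (List.mem_cons_of_mem _ hs)
      obtain ⟨h1, h2⟩ := ih a fun s hs u hu => h s (hsub s hs) u (hsub u hu)
      refine ⟨hsub _ h1, fun s hs => ?_⟩
      rcases List.mem_cons.1 hs with rfl | hs
      · exact h2 s List.mem_cons_self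
      · rcases List.mem_cons.1 hs with rfl | hs
        · refine (h2 a List.mem_cons_self).trans (not_lt.1 fun hlt' => ?_)
          simp [hba.2 hlt'] at hlt
        · exact h2 s (List.mem_cons_of_mem _ hs)

section Glue

variable {d : ℕ} {dom : Type} {enc : dom → List Bool}

theorem toRow_getD (r : Tuple d dom × ℚ≥0) (i : Fin d) :
    (toRow enc r).getD i [] = enc (r.1 i) := by
  have hi : (i : ℕ) < ((List.ofFn r.1).map enc).length := by simp
  rw [toRow, List.getD_append _ _ _ _ hi, List.getD_eq_getElem _ _ hi]
  simp

theorem fracRow_toRow (r : Tuple d dom × ℚ≥0) : fracRow d (toRow enc r) =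
    (Computability.encodeNat r.2.num, Computability.encodeNat r.2.den) := by
  have h : ((List.ofFn r.1).map enc).length = d := by simp
  rw [fracRow, toRow, List.getD_append_right _ _ _ _ (by omega),
    List.getD_append_right _ _ _ _ (by omega), h]
  simp

theorem fracVal_toRow (r : Tuple d dom × ℚ≥0) : fracVal (fracRow d (toRow enc r)) = r.2 := by
  rw [fracRow_toRow, fracVal, val_encodeNat, val_encodeNat, NNRat.num_div_den]

/-- The functional dependencies of a set with an lhs chain, ordered by their left-hand sides. -/
theorem exists_sorted_list {T : Finset (FD d)} (hT : HasLhsChain T) :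
    ∃ l : List (List (Fin d) × List (Fin d)), l.Pairwise (fun p q => p.1 ⊆ q.1) ∧
      ∀ I : Finset (Tuple d dom), Sat l I ↔ Satisfies I T := by
  -- Cardinality gives a total preorder to sort by; for comparable sets, smaller cardinality means
  -- inclusion.
  let r : FD d → FD d → Prop := fun φ ψ => φ.lhs.card ≤ ψ.lhs.card
  have : Std.Total r := ⟨fun φ ψ => le_total _ _⟩
  have : IsTrans (FD d) r := ⟨fun φ ψ χ => le_trans⟩
  have hmem : ∀ φ, φ ∈ T.toList.insertionSort r ↔ φ ∈ T := fun φ => by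
    rw [List.mem_insertionSort, Finset.mem_toList]
  refine ⟨(T.toList.insertionSort r).map fun φ => (φ.lhs.toList, φ.rhs.toList), ?_, fun I => ?_⟩
  · rw [List.pairwise_map]
    refine (List.pairwise_insertionSort r T.toList).imp_of_mem fun {φ ψ} hφ hψ h => ?_
    have hsub : φ.lhs ⊆ ψ.lhs := by
      rcases hT φ ((hmem φ).1 hφ) ψ ((hmem ψ).1 hψ) with h' | h'
      · exact h'
      · exact (Finset.eq_of_subset_of_card_le h' h).ge
    intro i hi
    simpa using hsub (by simpa using hi)
  · simp only [Sat, List.mem_map, forall_exists_index, and_imp, forall_apply_eq_imp_iff₂, hmem,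
      Agree, Finset.mem_toList, Satisfies, FD.Holds]

variable [DecidableEq dom]

/-- Injectivity of `enc` makes comparing strings the same as comparing values. -/
theorem agreeRow_toRow (henc : Function.Injective enc) (Z : List (Fin d))
    (r s : Tuple d dom × ℚ≥0) :
    agreeRow (Z.map Fin.val) (toRow enc r) (toRow enc s) = decide (Agree Z r.1 s.1) := by
  rw [Bool.eq_iff_iff]
  simp only [agreeRow, List.all_map, List.all_eq_true, Function.comp_apply, toRow_getD,
    beq_iff_eq, henc.eq_iff]
  exact (decide_eq_true_iff (p := Agree Z r.1 s.1)).symm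

/-- The set of the tuples in a list of weighted tuples. -/
def tupleSet (L : List (Tuple d dom × ℚ≥0)) : Finset (Tuple d dom) := (L.map Prod.fst).toFinset

theorem mem_tupleSet {L : List (Tuple d dom × ℚ≥0)} {t : Tuple d dom} :
    t ∈ tupleSet L ↔ ∃ r ∈ L, r.1 = t := by
  simp [tupleSet]

theorem filter_agreeRow_map (henc : Function.Injective enc) (Z : List (Fin d))
    (L : List (Tuple d dom × ℚ≥0)) (t : Tuple d dom × ℚ≥0) :
    ((L.map (toRow enc)).filter fun s => agreeRow (Z.map Fin.val) s (toRow enc t)) =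
      (L.filter fun s => decide (Agree Z s.1 t.1)).map (toRow enc) := by
  rw [List.filter_map]
  congr 2
  funext s
  exact agreeRow_toRow henc Z s t

theorem sum_map_snd {w : Tuple d dom → ℚ≥0} {L : List (Tuple d dom × ℚ≥0)}
    (hL : (L.map Prod.fst).Nodup) (hw : ∀ r ∈ L, w r.1 = r.2) :
    (L.map Prod.snd).sum = ∑ t ∈ tupleSet L, w t := by
  rw [tupleSet, List.sum_toFinset _ hL, List.map_map]
  congr 1
  exact List.map_congr_left fun r hr => (hw r hr).symm

theorem tupleSet_filter (L : List (Tuple d dom × ℚ≥0)) (Z : List (Fin d)) (t : Tuple d dom) :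
    tupleSet (L.filter fun s => decide (Agree Z s.1 t)) = cls Z t (tupleSet L) := by
  ext x
  simp only [mem_tupleSet, mem_cls, List.mem_filter, decide_eq_true_eq]
  constructor
  · rintro ⟨r, ⟨hr, h⟩, rfl⟩
    exact ⟨⟨r, hr, rfl⟩, h⟩
  · rintro ⟨⟨r, hr, rfl⟩, h⟩
    exact ⟨r, ⟨hr, h⟩, rfl⟩

theorem weightRow_toRow (henc : Function.Injective enc) {w : Tuple d dom → ℚ≥0}
    (Z : List (Fin d)) {L : List (Tuple d dom × ℚ≥0)}
    (hL : (L.map Prod.fst).Nodup) (hw : ∀ r ∈ L, w r.1 = r.2) (t : Tuple d dom × ℚ≥0) :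
    0 < val (weightRow d (Z.map Fin.val) (L.map (toRow enc)) (toRow enc t)).2 ∧
      fracVal (weightRow d (Z.map Fin.val) (L.map (toRow enc)) (toRow enc t)) =
        ∑ x ∈ cls Z t.1 (tupleSet L), w x := by
  have h := sumFrac_spec (((L.map (toRow enc)).filter fun s =>
    agreeRow (Z.map Fin.val) s (toRow enc t)).map fun s => fracRow d s) (by
      intro p hp
      rw [filter_agreeRow_map henc] at hp
      simp only [List.map_map, List.mem_map, Function.comp_apply] at hp
      obtain ⟨r, -, rfl⟩ := hp
      rw [fracRow_toRow, val_encodeNat]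
      exact r.2.den_pos)
  refine ⟨h.1, h.2.trans ?_⟩
  rw [filter_agreeRow_map henc, List.map_map, List.map_map, ← tupleSet_filter,
    ← sum_map_snd (hL.sublist (List.filter_sublist.map _))
      fun r hr => hw r (List.mem_of_mem_filter hr)]
  congr 1
  exact List.map_congr_left fun r _ => fracVal_toRow r

/-- The result is a sublist of the rows and not just a set: its tuples remain distinct and keep
their weights, so that the next pass can be applied to it. -/
theorem passRow_toRow (henc : Function.Injective enc) {w : Tuple d dom → ℚ≥0}
    (Z Y : List (Fin d)) {L : List (Tuple d dom × ℚ≥0)}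
    (hL : (L.map Prod.fst).Nodup) (hw : ∀ r ∈ L, w r.1 = r.2) :
    ∃ L' : List (Tuple d dom × ℚ≥0), L'.Sublist L ∧
      passRow d (Z.map Fin.val) (Y.map Fin.val) (L.map (toRow enc)) = L'.map (toRow enc) ∧
      IsPass w Z Y (tupleSet L) (tupleSet L') := by
  refine ⟨_, List.filter_sublist, List.filter_map, ?_, ?_⟩
  · intro x hx
    obtain ⟨r, hr, rfl⟩ := mem_tupleSet.1 hx
    exact mem_tupleSet.2 ⟨r, List.mem_of_mem_filter hr, rfl⟩
  intro t ht
  obtain ⟨t, htL, rfl⟩ := mem_tupleSet.1 ht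
  have hmemL : ∀ s ∈ tupleSet L, ∃ r ∈ L, r.1 = s := fun s hs => mem_tupleSet.1 hs
  -- Tuples of the same class filter out the same list, ties included, and so select the same row.
  -- This makes the tuple-by-tuple test of `passRow` keep a single block per class.
  have hbest : ∀ s ∈ L, Agree Z s.1 t.1 →
      bestRow d (Z.map Fin.val) (Y.map Fin.val) (L.map (toRow enc)) (toRow enc s) =
      bestRow d (Z.map Fin.val) (Y.map Fin.val) (L.map (toRow enc)) (toRow enc t) := by
    intro s _ hst
    have : (L.filter fun u => decide (Agree Z u.1 s.1)) =
        L.filter fun u => decide (Agree Z u.1 t.1) :=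
      List.filter_congr fun u _ => by
        rw [decide_eq_decide]
        exact ⟨fun h => h.trans hst, fun h => h.trans hst.symm⟩
    rw [bestRow, bestRow, filter_agreeRow_map henc, filter_agreeRow_map henc, this]
  obtain ⟨c, hc, hcbest, hcmin⟩ : ∃ c ∈ L.filter fun u => decide (Agree Z u.1 t.1),
      bestRow d (Z.map Fin.val) (Y.map Fin.val) (L.map (toRow enc)) (toRow enc t) = toRow enc c ∧
      ∀ s ∈ L.filter fun u => decide (Agree Z u.1 t.1),
        ∑ x ∈ cls (Z ++ Y) c.1 (tupleSet L), w x ≤ ∑ x ∈ cls (Z ++ Y) s.1 (tupleSet L), w x := by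
    rw [bestRow, filter_agreeRow_map henc, ← List.map_append]
    have htF : t ∈ L.filter fun u => decide (Agree Z u.1 t.1) := by
      simpa using ⟨htL, Agree.refl Z t.1⟩
    generalize L.filter (fun u => decide (Agree Z u.1 t.1)) = F at htF
    -- The class contains `t`, so the default value in `bestRow` is never used; the fold starts at
    -- the head `a` and meets it once more.
    obtain ⟨a, F, rfl⟩ := List.exists_cons_of_ne_nil (List.ne_nil_of_mem htF)
    have hmem : ∀ u ∈ toRow enc a :: (a :: F).map (toRow enc),
        ∃ r ∈ a :: F, u = toRow enc r := by
      intro u hu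
      rcases List.mem_cons.1 hu with rfl | hu
      · exact ⟨a, List.mem_cons_self, rfl⟩
      · obtain ⟨r, hr, rfl⟩ := List.mem_map.1 hu
        exact ⟨r, hr, rfl⟩
    obtain ⟨h1, h2⟩ := foldl_min
      (fun s c => ltFrac (weightRow d ((Z ++ Y).map Fin.val) (L.map (toRow enc)) s)
        (weightRow d ((Z ++ Y).map Fin.val) (L.map (toRow enc)) c))
      (fun s => fracVal (weightRow d ((Z ++ Y).map Fin.val) (L.map (toRow enc)) s))
      ((a :: F).map (toRow enc)) (toRow enc a) (by
        intro s hs u hu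
        obtain ⟨s, -, rfl⟩ := hmem s hs
        obtain ⟨u, -, rfl⟩ := hmem u hu
        exact ltFrac_iff (weightRow_toRow henc _ hL hw s).1 (weightRow_toRow henc _ hL hw u).1)
    obtain ⟨c, hc, hceq⟩ := hmem _ h1
    refine ⟨c, hc, hceq, fun s hs => ?_⟩
    have := h2 (toRow enc s) (List.mem_cons_of_mem _ (List.mem_map_of_mem hs))
    rw [hceq] at this
    simpa only [(weightRow_toRow henc _ hL hw _).2] using this
  simp only [List.mem_filter, decide_eq_true_eq] at hc hcmin
  refine ⟨c.1, mem_tupleSet.2 ⟨c, hc.1, rfl⟩, hc.2, ?_, ?_⟩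
  · intro s hs hst
    obtain ⟨s, hsL, rfl⟩ := hmemL s hs
    exact hcmin s ⟨hsL, hst⟩
  · intro s hs hst
    obtain ⟨s, hsL, rfl⟩ := hmemL s hs
    simp only [mem_tupleSet, List.mem_filter, Function.comp_apply]
    constructor
    · rintro ⟨r, ⟨hr, hag⟩, hrs⟩
      rw [hbest r hr (hrs ▸ hst), hcbest, agreeRow_toRow henc, decide_eq_true_eq, hrs] at hag
      exact hag
    · intro hag
      refine ⟨s, ⟨hsL, ?_⟩, rfl⟩
      rw [hbest s hsL hst, hcbest, agreeRow_toRow henc, decide_eq_true_eq]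
      exact hag

theorem runRow_toRow (henc : Function.Injective enc) {w : Tuple d dom → ℚ≥0}
    {L : List (Tuple d dom × ℚ≥0)} (hL : (L.map Prod.fst).Nodup) (hw : ∀ r ∈ L, w r.1 = r.2)
    (l : List (List (Fin d) × List (Fin d))) : ∀ C : List (Fin d),
    ∃ L' : List (Tuple d dom × ℚ≥0), L'.Sublist L ∧
      runRow d (l.map (Prod.map (List.map Fin.val) (List.map Fin.val))) (C.map Fin.val)
        (L.map (toRow enc)) = L'.map (toRow enc) ∧ IsRun w l C (tupleSet L) (tupleSet L') := by
  induction l with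
  | nil => exact fun C => ⟨L, List.Sublist.refl _, rfl, rfl⟩
  | cons p l ih =>
    intro C
    obtain ⟨X, Y⟩ := p
    obtain ⟨L₁, hsub, heq, hrun⟩ := ih (C ++ X ++ Y)
    obtain ⟨L₂, hsub', heq', hpass⟩ := passRow_toRow henc (C ++ X) Y (w := w)
      (hL.sublist (hsub.map _)) fun r hr => hw r (hsub.subset hr)
    refine ⟨L₂, hsub'.trans hsub, ?_, _, hrun, hpass⟩
    rw [← heq', ← heq]
    simp [runRow]

theorem exists_weight (D : WeightedInstance d dom) : ∃ w : Tuple d dom → ℚ≥0,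
    (∀ r ∈ D.rows, w r.1 = r.2) ∧ ∀ E ⊆ D.tuples, D.weight E = ∑ t ∈ E, w t := by
  classical
  obtain ⟨w, hw⟩ : ∃ w : Tuple d dom → ℚ≥0, ∀ r ∈ D.rows, w r.1 = r.2 := by
    -- As no tuple is listed twice, the chosen weight is the listed one; the value 0 elsewhere is
    -- arbitrary.
    refine ⟨fun t => if h : ∃ q, (t, q) ∈ D.rows then h.choose else 0, fun r hr => ?_⟩
    have h : ∃ q, (r.1, q) ∈ D.rows := ⟨r.2, hr⟩
    simp only [dif_pos h]
    exact congrArg Prod.snd (List.inj_on_of_nodup_map D.nodup h.choose_spec hr rfl)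
  refine ⟨w, hw, fun E hE => ?_⟩
  rw [WeightedInstance.weight, sum_map_snd (D.nodup.sublist (List.filter_sublist.map _))
    fun r hr => hw r (List.mem_of_mem_filter hr)]
  congr 1
  ext t
  simp only [mem_tupleSet, List.mem_filter, decide_eq_true_eq]
  constructor
  · rintro ⟨r, ⟨-, h⟩, rfl⟩
    exact h
  · intro ht
    obtain ⟨r, hr, rfl⟩ := mem_tupleSet.1 (hE ht)
    exact ⟨r, ⟨hr, ht⟩, rfl⟩

end Glue

end MinRepair

theorem mainTheorem4 {d : ℕ} {dom : Type} [DecidableEq dom]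
    (enc : dom → List Bool) (henc : Function.Injective enc)
    (S : Finset (MinRepair.FD d))
    (hS : ∃ T : Finset (MinRepair.FD d),
      MinRepair.Equivalent dom S T ∧ MinRepair.HasLhsChain T) :
    MinRepair.SolvableInPolyTime
      (MinRepair.encodeInstance (d := d) enc) (MinRepair.encodeTuples (d := d) enc)
      (MinRepair.MinRepairSolution S) := by
  open MinRepair in
  obtain ⟨T, hST, hT⟩ := hS
  obtain ⟨l, hl, hsat⟩ := exists_sorted_list (dom := dom) hT
  have hsat' : ∀ I : Finset (Tuple d dom), Satisfies I S ↔ Sat l I := fun I =>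
    (hST I).trans (hsat I).symm
  have hrep : ∀ D E : Finset (Tuple d dom), IsRepair S D E ↔ IsRep l D E := fun D E => by
    simp only [IsRepair, IsRep, hsat']
  choose w hw hweight using fun D : WeightedInstance d dom => exists_weight D
  choose L hsub heq hrun using fun D : WeightedInstance d dom =>
    runRow_toRow henc D.nodup (hw D) l []
  refine ⟨fun D => (L D).map Prod.fst, PT.computableInPolyTime
    (((PT.unparse d).comp ((PT.runRow d (l.map (Prod.map (List.map Fin.val)
      (List.map Fin.val))) []).comp PT.parse_reverse)).reverse) fun D => ?_, fun D => ?_⟩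
  · rw [List.reverse_reverse, parse_encodeInstance, ← unparse_toRow, ← heq D]
    rfl
  · refine ⟨D.nodup.sublist ((hsub D).map _), ?_⟩
    have hmin : IsMinRep (w D) l D.tuples (tupleSet (L D)) := by
      obtain ⟨hsubset, h⟩ := (hrun D).isMinRep hl
      -- Agreement on no attributes leaves at most one class; passing through the classes also
      -- covers the empty instance, which has none.
      exact isMinRep_of_cls (X := []) (fun p _ => List.nil_subset _) hsubset h
    refine ⟨(hrep _ _).2 hmin.1, fun E' hE' => ?_⟩
    rw [hrep] at hE'
    change D.weight (tupleSet (L D)) ≤ _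
    rw [hweight D _ hmin.1.1.1, hweight D _ hE'.1.1]
    exact hmin.2 E' hE'
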